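/- Let $M$ be a smooth ($C^\infty$) manifold (Hausdorff, second countable, without boundary), and let $G$ be a compact Lie group acting smoothly on $M$. A stochastic dynamical system (SDS) on a manifold, written $X = X_0 + \sum_{i=1}^k X_i \circ \frac{dB^i_t}{dt}$, is given by smooth vector fields $X_0, X_1, \dots, X_k$ on it; its generator is the second-order differential operator $A_X = X_0 + \frac12\sum_{i=1}^k X_i^2$. A smooth map $\Phi : (M,X)\to(N,Y)$ is a diffusion morphism if $A_X(f\circ\Phi) = (A_Y f)\circ\Phi$ for every smooth function $f : N\to\mathbb{R}$. The SDS $X$ is diffusion invariant under the action if $A_X$ is $G$-invariant, i.e. for every $g\in G$ the map $x\mapsto g\cdot x$ is a diffusion morphism from $(M,X)$ to itself. Call $x \in M$ regular if all points $y$ in some neighbourhood of $x$ have stabilizers $G_y$ conjugate to $G_x$ in $G$ (i.e. $x$ lies on a principal orbit). Let $M_{\mathrm{reg}}\subseteq M$ be the open set of regular points, and let the regular part of $M/G$ be its image $M_{\mathrm{reg}}/G$, an open subset of $M/G$ with the quotient topology. Theorem. Let $X = X_0 + \sum_{i=1}^k X_i \circ \frac{dB_t^i}{dt}$ be an SDS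 on $M$ which is diffusion invariant under the action of the compact Lie group $G$. Then the regular part $M_{\mathrm{reg}}/G$ of $M/G$ is a smooth manifold (its components are allowed to have different dimensions; $M$ is not assumed connected) such that the projection $\pi : M_{\mathrm{reg}}\to M_{\mathrm{reg}}/G$ is a smooth submersion, and there exist $m\in\mathbb{N}$ and an SDS $Z = Z_0 + \sum_{i=1}^m Z_i\circ\frac{dW^i_t}{dt}$ on $M_{\mathrm{reg}}/G$ whose generator is the projection of $A_X$: $$A_X(f\circ\pi) = (A_Z f)\circ\pi,\qquad A_Z = Z_0+\tfrac12\sum_{i=1}^m Z_i^2,$$ for every smooth function $f$ on $M_{\mathrm{reg}}/G$. In other words, $\pi : (M_{\mathrm{reg}},X|_{M_{\mathrm{reg}}})\to (M_{\mathrm{reg}}/G, Z)$ is a diffusion morphism. -/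

import Mathlib

open Set Filter Topology TopologicalSpace MulAction
open scoped Manifold ContDiff

noncomputable section

/-! ### Stochastic dynamical systems and their generators -/

section SDS

variable {E H : Type*} [NormedAddCommGroup E] [NormedSpace ℝ E] [TopologicalSpace H]
  (I : ModelWithCorners ℝ E H) (M : Type*) [TopologicalSpace M] [ChartedSpace H M]

/-- A stochastic dynamical system `X₀ + ∑ Xᵢ ∘ dBⁱ/dt` (in Stratonovich form, with `k` noise terms)
on `M`: a smooth drift vector field `X₀` and smooth vector fields `X₁, …, X_k`. -/
structure SDS [IsManifold I ∞ M] (k : ℕ) where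
  drift : (x : M) → TangentSpace I x
  noise : Fin k → (x : M) → TangentSpace I x
  contMDiff_drift :
    ContMDiff I I.tangent ∞ (fun x => (⟨x, drift x⟩ : TangentBundle I M))
  contMDiff_noise : ∀ i,
    ContMDiff I I.tangent ∞ (fun x => (⟨x, noise i x⟩ : TangentBundle I M))

variable {I M}

/-- The action `f ↦ V f` of a vector field on functions. -/
def lieDeriv (V : (x : M) → TangentSpace I x) (f : M → ℝ) : M → ℝ :=
  fun x => mvfderiv I f x (V x)

/-- The generator (diffusion operator) `A_X = X₀ + ½ ∑ Xᵢ²`. -/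
def SDS.generator [IsManifold I ∞ M] {k : ℕ} (X : SDS I M k) (f : M → ℝ) : M → ℝ :=
  fun x => lieDeriv X.drift f x +
    (1 / 2 : ℝ) * ∑ i, lieDeriv (X.noise i) (lieDeriv (X.noise i) f) x

/-- `Φ : (M, X) → (N, Y)` is a diffusion morphism: `Φ` is smooth and
`A_X (Φ^* f) = Φ^* (A_Y f)` for every smooth function `f` on `N`. -/
def IsDiffusionMorphism {E' H' : Type*} [NormedAddCommGroup E'] [NormedSpace ℝ E']
    [TopologicalSpace H'] {J : ModelWithCorners ℝ E' H'} {N : Type*} [TopologicalSpace N]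
    [ChartedSpace H' N] [IsManifold I ∞ M] [IsManifold J ∞ N] {k l : ℕ} (X : SDS I M k) (Y : SDS J N l) (Φ : M → N) : Prop :=
  ContMDiff I J ∞ Φ ∧
    ∀ f : N → ℝ, ContMDiff J 𝓘(ℝ, ℝ) ∞ f → X.generator (f ∘ Φ) = Y.generator f ∘ Φ

/-- `X` is diffusion invariant under an action of `G`: every `g : G` acts as a diffusion morphism
from `(M, X)` to itself, i.e. `A_X` commutes with `f ↦ f (g • ·)`. -/
def SDS.IsDiffusionInvariant [IsManifold I ∞ M] {k : ℕ} (X : SDS I M k) (G : Type*) [SMul G M] : Prop :=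
  ∀ g : G, IsDiffusionMorphism X X (fun x => g • x)

lemma isInvertible_mfderiv_subtypeVal (U : Opens M) (x : U) :
    (mfderiv I I (Subtype.val : U → M) x).IsInvertible := by
  classical
  let r : M → U := fun y => if h : y ∈ U then ⟨y, h⟩ else x
  have hr : ContMDiffAt I I ∞ r x := by
    rw [← ContMDiffAt.subtypeVal_comp_iff]
    refine (contMDiffAt_id (I := I) (n := ∞)).congr_of_eventuallyEq ?_
    filter_upwards [U.isOpen.mem_nhds x.2] with y hy
    have hy' : y ∈ U := hy
    simp [r, hy']
  have hv : ContMDiffAt I I ∞ (Subtype.val : U → M) x := contMDiff_subtype_val x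
  have hrx : r x.1 = x := by simp [r]
  have hrv : r ∘ Subtype.val = id := by
    ext y
    simp [r]
  have hvr : Subtype.val ∘ r =ᶠ[𝓝 x.1] id := by
    filter_upwards [U.isOpen.mem_nhds x.2] with y hy
    have hy' : y ∈ U := hy
    simp [r, hy']
  have hr' := hr.mdifferentiableAt (by simp)
  have hv' := hv.mdifferentiableAt (by simp)
  have h1 : (mfderiv I I r x.1).comp (mfderiv I I (Subtype.val : U → M) x) =
      ContinuousLinearMap.id ℝ _ := by
    rw [← mfderiv_comp x hr' hv', hrv, mfderiv_id]
  have h2 : (mfderiv I I (Subtype.val : U → M) x).comp (mfderiv I I r x.1) =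
      ContinuousLinearMap.id ℝ _ := by
    have hv'' : MDifferentiableAt I I (Subtype.val : U → M) (r x.1) := by rw [hrx]; exact hv'
    have := mfderiv_comp x.1 hv'' hr'
    rw [hvr.mfderiv_eq, mfderiv_id, hrx] at this
    exact this.symm
  exact ContinuousLinearMap.IsInvertible.of_inverse h2 h1

/-- The restriction of a stochastic dynamical system to an open subset. -/
def SDS.restrict [CompleteSpace E] [IsManifold I ∞ M] {k : ℕ} (X : SDS I M k) (U : Opens M) :
    SDS I U k :=
  { drift := VectorField.mpullback I I Subtype.val X.drift
    noise := fun i => VectorField.mpullback I I Subtype.val (X.noise i)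
    contMDiff_drift := ContMDiff.mpullback_vectorField (n := ∞) X.contMDiff_drift
      contMDiff_subtype_val (isInvertible_mfderiv_subtypeVal U) le_rfl
    contMDiff_noise := fun i => ContMDiff.mpullback_vectorField (n := ∞) (X.contMDiff_noise i)
      contMDiff_subtype_val (isInvertible_mfderiv_subtypeVal U) le_rfl }

end SDS

/-! ### The regular part of an orbit space -/

section OrbitSpace

variable (G : Type*) {M : Type*} [Group G] [MulAction G M]

/-- `x` and `y` have the same orbit type: their stabilizers are conjugate in `G`. -/
def SameOrbitType (x y : M) : Prop :=
  ∃ g : G, stabilizer G y = (stabilizer G x).map (MulAut.conj g).toMonoidHom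

lemma SameOrbitType.symm {x y : M} (h : SameOrbitType G x y) : SameOrbitType G y x := by
  obtain ⟨g, hg⟩ := h
  refine ⟨g⁻¹, ?_⟩
  rw [hg, Subgroup.map_map]
  ext a
  simp [Subgroup.mem_map, mul_assoc]

lemma SameOrbitType.trans {x y z : M} (h : SameOrbitType G x y) (h' : SameOrbitType G y z) :
    SameOrbitType G x z := by
  obtain ⟨g, hg⟩ := h
  obtain ⟨g', hg'⟩ := h'
  refine ⟨g' * g, ?_⟩
  rw [hg', hg, Subgroup.map_map]
  ext a
  simp [Subgroup.mem_map, mul_assoc]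

/-- `x` is a regular point (it lies on a principal orbit) if the orbit type is constant
near `x`. -/
def IsRegularPoint [TopologicalSpace M] (x : M) : Prop :=
  ∀ᶠ y in 𝓝 x, SameOrbitType G x y

lemma isOpen_setOf_isRegularPoint [TopologicalSpace M] :
    IsOpen {x : M | IsRegularPoint G x} := by
  rw [isOpen_iff_mem_nhds]
  intro x hx
  have hx' : ∀ᶠ y in 𝓝 x, SameOrbitType G x y := hx
  filter_upwards [hx', hx'.eventually_nhds] with y hy hy'
  exact hy'.mono fun z hz => (hy.symm G).trans G hz

variable (M)

/-- The regular part of the orbit space `M/G`: the orbits of regular points. -/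
def regularPart [TopologicalSpace M] [ContinuousConstSMul G M] : Opens (orbitRel.Quotient G M) where
  carrier := Quotient.mk _ '' {x : M | IsRegularPoint G x}
  is_open' := isOpenMap_quotient_mk'_mul _ (isOpen_setOf_isRegularPoint G)

variable {M G}

/-- The preimage in `M` of an open subset of `M/G`. -/
def orbitPreimage [TopologicalSpace M] (V : Opens (orbitRel.Quotient G M)) : Opens M where
  carrier := {x | (Quotient.mk _ x : orbitRel.Quotient G M) ∈ V}
  is_open' := V.isOpen.preimage continuous_quotient_mk'

/-- The orbit projection, over an open subset of `M/G`. -/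
def orbitProj [TopologicalSpace M] (V : Opens (orbitRel.Quotient G M)) : orbitPreimage V → V :=
  fun x => ⟨Quotient.mk _ x.1, x.2⟩

/-- A structure of smooth manifold on an open subset `V` of `M/G` (with its quotient topology),
for which the orbit projection is a smooth submersion. The components of `V` may have different
dimensions: `piece d` is the `d`-dimensional part of `V`, so `V` is the disjoint union of the
open sets `piece 0, piece 1, …`, each one a smooth manifold of the indicated dimension. -/
structure OrbitManifold {E H : Type*} [NormedAddCommGroup E] [NormedSpace ℝ E]
    [TopologicalSpace H] (I : ModelWithCorners ℝ E H) [TopologicalSpace M] [ChartedSpace H M]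
    (V : Opens (orbitRel.Quotient G M)) where
  piece : ℕ → Opens (orbitRel.Quotient G M)
  disjoint_piece : Pairwise (Function.onFun Disjoint piece)
  iSup_piece : ⨆ d, piece d = V
  chartedSpace : ∀ d, ChartedSpace (EuclideanSpace ℝ (Fin d)) (piece d)
  isManifold : ∀ d, IsManifold (𝓡 d) ∞ (piece d)
  contMDiff_proj : ∀ d, ContMDiff I (𝓡 d) ∞ (orbitProj (piece d))
  surjective_mfderiv_proj : ∀ d (x : orbitPreimage (piece d)),
    Function.Surjective (mfderiv I (𝓡 d) (orbitProj (piece d)) x)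

instance {E H : Type*} [NormedAddCommGroup E] [NormedSpace ℝ E]
    [TopologicalSpace H] (I : ModelWithCorners ℝ E H) [TopologicalSpace M] [ChartedSpace H M]
    (V : Opens (orbitRel.Quotient G M)) (S : OrbitManifold I V) (d : ℕ) :
    ChartedSpace (EuclideanSpace ℝ (Fin d)) (S.piece d) :=
  S.chartedSpace d

instance {E H : Type*} [NormedAddCommGroup E] [NormedSpace ℝ E]
    [TopologicalSpace H] (I : ModelWithCorners ℝ E H) [TopologicalSpace M] [ChartedSpace H M]
    (V : Opens (orbitRel.Quotient G M)) (S : OrbitManifold I V) (d : ℕ) :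
    IsManifold (𝓡 d) ∞ (S.piece d) :=
  S.isManifold d

end OrbitSpace

end

/-! The proof has two halves: the regular orbit space is a manifold, and a generator that descends
along a surjective submersion descends to the generator of an SDS with finitely many noise fields.

Manifold structure. The inverse function theorem gives coordinates `e (j a) • σ c` near a point `x`
(`nonempty_orbitCoordinates`). The dimension of an orbit depends only on its type
(`SameOrbitType.orbitRank_eq`), so near a regular `x` it is constant, and then the transversal
coordinate `c` does not change under group elements near `1`. By compactness of `G`, an element
moving a point near `x` to another point near `x` is `u * h` with `u` near `1` and `h` fixing `x`.
Nearby stabilizers are conjugate to that of `x` by elements near `1`, which forces `h` to preserve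
`c` as well. So `c` is a submersion whose fibres near `x` are the traces of the orbits
(`IsRegularPoint.exists_submersion`), and such submersions induce the charts of the quotient
(`exists_quotientManifold`). There is one piece for each codimension of orbits.

Generator. Invariance makes `A_X (f ∘ π)` constant on orbits, so the second-order part of the
induced operator can be computed at any point of a fibre. Take smooth local sections `s_c` of `π`
over open sets `W_c` covering the quotient, and functions `χ_c` supported in `W_c` with `∑ χ_c ^ 2 =
1`. The fields `χ_c dπ(X_i ∘ s_c)` have the right second-order part, and what remains is a
first-order operator, the drift (`vecGenerator_comp_eq`). Finitely many `W_c` suffice even without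
compactness, because open covers of a `d`-manifold have refinements of order at most `2 ^ d`
(`exists_finite_cover_of_local`). -/

noncomputable section

set_option linter.unusedSectionVars false

/-! ### Local sections and local inverses of smooth maps -/

section InverseFunction

/-- Local inverse of a smooth map with invertible derivative, smooth on a neighbourhood. -/
lemma exists_smooth_localInverse {F : Type*} [NormedAddCommGroup F] [NormedSpace ℝ F]
    [CompleteSpace F] {k : F → F} {c : F} (hk : ∀ᶠ u in 𝓝 c, ContDiffAt ℝ ∞ k u)
    (hd : HasFDerivAt k (ContinuousLinearMap.id ℝ F) c) :
    ∃ q : F → F, q (k c) = c ∧ ∀ᶠ y in 𝓝 (k c), ContDiffAt ℝ ∞ q y ∧ k (q y) = y := by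
  have hd' : HasFDerivAt k ((ContinuousLinearEquiv.refl ℝ F : F ≃L[ℝ] F) : F →L[ℝ] F) c := hd
  have hkc := hk.self_of_nhds
  set e := hkc.toOpenPartialHomeomorph k hd' (by simp) with he
  have hecoe : (e : F → F) = k := hkc.toOpenPartialHomeomorph_coe hd' (by simp)
  have hcs : c ∈ e.source := hkc.mem_toOpenPartialHomeomorph_source hd' (by simp)
  have hct : k c ∈ e.target := hkc.image_mem_toOpenPartialHomeomorph_target hd' (by simp)
  have hinv : e.symm (k c) = c := by
    rw [← hecoe]; exact e.left_inv hcs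
  refine ⟨e.symm, hinv, ?_⟩
  -- Invertibility of the derivative is an open condition, so the inverse is smooth at every point
  -- near `k c` and not only at `k c` itself.
  have hunit : ∀ᶠ u in 𝓝 c, fderiv ℝ k u ∈
      range ((↑) : (F ≃L[ℝ] F) → F →L[ℝ] F) := by
    have hcont : ContinuousAt (fderiv ℝ k) c :=
      (hkc.fderiv_right (m := 0) (by simp)).continuousAt
    refine hcont.eventually ?_
    have := ContinuousLinearEquiv.nhds (𝕜 := ℝ) (ContinuousLinearEquiv.refl ℝ F)
    rw [hd'.fderiv]
    exact this
  have hsymm : Tendsto e.symm (𝓝 (k c)) (𝓝 c) := by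
    have := e.symm.continuousAt (x := k c) hct
    rwa [ContinuousAt, hinv] at this
  filter_upwards [e.open_target.mem_nhds hct, hsymm.eventually hk, hsymm.eventually hunit]
    with y hy hy1 ⟨A, hA⟩
  constructor
  · refine e.contDiffAt_symm hy (f₀' := A) ?_ ?_
    · rw [hA, hecoe]; exact (hy1.differentiableAt (by simp)).hasFDerivAt
    · rw [hecoe]; exact hy1
  · rw [← hecoe]; exact e.right_inv hy

variable {E F : Type*} [NormedAddCommGroup E] [NormedSpace ℝ E]
  [NormedAddCommGroup F] [NormedSpace ℝ F] [FiniteDimensional ℝ F]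
  {M N : Type*} [TopologicalSpace M] [ChartedSpace E M] [IsManifold 𝓘(ℝ, E) ∞ M]
  [TopologicalSpace N] [ChartedSpace F N] [IsManifold 𝓘(ℝ, F) ∞ N]

/-- A submersion at `x` has a smooth local section through `x`. -/
lemma exists_localSection {f : M → N} {x : M}
    (hf : ∀ᶠ x' in 𝓝 x, ContMDiffAt 𝓘(ℝ, E) 𝓘(ℝ, F) ∞ f x')
    (hs : Function.Surjective (mfderiv 𝓘(ℝ, E) 𝓘(ℝ, F) f x)) :
    ∃ s : N → M, s (f x) = x ∧
      ∀ᶠ y in 𝓝 (f x), ContMDiffAt 𝓘(ℝ, F) 𝓘(ℝ, E) ∞ s y ∧ f (s y) = y := by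
  have : CompleteSpace F := FiniteDimensional.complete ℝ F
  set φ := extChartAt 𝓘(ℝ, E) x with hφ
  set ψ := extChartAt 𝓘(ℝ, F) (f x) with hψ
  have hfx := hf.self_of_nhds
  set L : E →L[ℝ] F := mfderiv 𝓘(ℝ, E) 𝓘(ℝ, F) f x with hL
  -- Restricted to the affine subspace `φ x + range R`, the map `f` read in charts has derivative `L
  -- ∘ R = id`, and the ordinary inverse function theorem applies.
  obtain ⟨R, hR⟩ := L.exists_rightInverse_of_surjective (LinearMap.range_eq_top.2 hs)
  set h : E → F := fun u => ψ (f (φ.symm u)) with hh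
  have hφt : φ.target ∈ 𝓝 (φ x) := extChartAt_target_mem_nhds x
  have hφs : ContinuousAt φ.symm (φ x) := continuousAt_extChartAt_symm x
  have hφsx : φ.symm (φ x) = x := extChartAt_to_inv x
  have hφtend : Tendsto φ.symm (𝓝 (φ x)) (𝓝 x) := by
    have := hφs.tendsto; rwa [hφsx] at this
  have hφsmooth : ∀ᶠ u in 𝓝 (φ x), ContMDiffAt 𝓘(ℝ, E) 𝓘(ℝ, E) ∞ φ.symm u := by
    filter_upwards [eventually_mem_nhds_iff.2 hφt] with u hu
    exact (contMDiffOn_extChartAt_symm x).contMDiffAt hu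
  have hψsrc : ∀ᶠ y in 𝓝 (f x), y ∈ ψ.source := extChartAt_source_mem_nhds (f x)
  have hsm : ∀ᶠ u in 𝓝 (φ x), ContDiffAt ℝ ∞ h u := by
    filter_upwards [hφsmooth, hφtend.eventually hf,
      hφtend.eventually (hfx.continuousAt.eventually hψsrc)] with u h1 h2 h3
    rw [← contMDiffAt_iff_contDiffAt]
    have h4 : ContMDiffAt 𝓘(ℝ, F) 𝓘(ℝ, F) ∞ ψ (f (φ.symm u)) :=
      contMDiffAt_extChartAt' (by simpa [hψ] using h3)
    exact h4.comp u (h2.comp u h1)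
  have hder : HasFDerivAt h L (φ x) := by
    have h0 : HasFDerivWithinAt h L (range 𝓘(ℝ, E)) (φ x) :=
      (hfx.mdifferentiableAt (by simp)).hasMFDerivAt.2
    rwa [ModelWithCorners.range_eq_univ, hasFDerivWithinAt_univ] at h0
  set k : F → F := fun c => h (φ x + R c) with hk
  have haff : Tendsto (fun c => φ x + R c) (𝓝 0) (𝓝 (φ x)) := by
    have : Continuous fun c => φ x + R c := by fun_prop
    simpa using this.tendsto 0
  have hk1 : ∀ᶠ c in 𝓝 (0 : F), ContDiffAt ℝ ∞ k c := by
    filter_upwards [haff.eventually hsm] with c hc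
    have : ContDiffAt ℝ ∞ (fun c => φ x + R c) c := by fun_prop
    exact ContDiffAt.comp (g := h) (f := fun c => φ x + R c) c hc this
  have hk2 : HasFDerivAt k (ContinuousLinearMap.id ℝ F) 0 := by
    have h1 : HasFDerivAt (fun c => φ x + R c) R 0 := by
      simpa using R.hasFDerivAt.const_add (φ x)
    have h2 : HasFDerivAt h L (φ x + R 0) := by simpa using hder
    have := h2.comp 0 h1
    rwa [hR] at this
  obtain ⟨q, hq0, hq⟩ := exists_smooth_localInverse hk1 hk2
  have hk0 : k 0 = ψ (f x) := by simp [hk, hh, hφsx]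
  rw [hk0] at hq0 hq
  have hψc : Tendsto ψ (𝓝 (f x)) (𝓝 (ψ (f x))) := continuousAt_extChartAt (f x)
  have hqc : Tendsto q (𝓝 (ψ (f x))) (𝓝 0) := by
    have := hq.self_of_nhds.1.continuousAt.tendsto
    rwa [hq0] at this
  have hall : Tendsto (fun y => φ x + R (q (ψ y))) (𝓝 (f x)) (𝓝 (φ x)) :=
    haff.comp (hqc.comp hψc)
  refine ⟨fun y => φ.symm (φ x + R (q (ψ y))), by simp [hq0, hφsx], ?_⟩
  filter_upwards [hψsrc, hψc.eventually hq, hall.eventually hφsmooth,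
    (hφtend.comp hall).eventually (hfx.continuousAt.eventually hψsrc)] with y h1 h2 h3 h4
  constructor
  · have h5 : ContMDiffAt 𝓘(ℝ, F) 𝓘(ℝ, F) ∞ ψ y :=
      contMDiffAt_extChartAt' (by simpa [hψ] using h1)
    have h6 : ContDiffAt ℝ ∞ (fun v => φ x + R (q v)) (ψ y) := by
      have := h2.1
      fun_prop
    exact h3.comp y (h6.contMDiffAt.comp y h5)
  · exact ψ.injOn h4 h1 h2.2

/-- The image of a neighbourhood under a submersion is a neighbourhood. -/
lemma image_mem_nhds_of_surjective_mfderiv {f : M → N} {x : M}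
    (hf : ∀ᶠ x' in 𝓝 x, ContMDiffAt 𝓘(ℝ, E) 𝓘(ℝ, F) ∞ f x')
    (hs : Function.Surjective (mfderiv 𝓘(ℝ, E) 𝓘(ℝ, F) f x)) {W : Set M} (hW : W ∈ 𝓝 x) :
    f '' W ∈ 𝓝 (f x) := by
  obtain ⟨s, hsx, h⟩ := exists_localSection hf hs
  have hc := h.self_of_nhds.1.continuousAt
  rw [ContinuousAt, hsx] at hc
  filter_upwards [h, hc hW] with y hy hy'
  exact ⟨s y, hy', hy.2⟩

/-- A smooth map with bijective derivative at `x` has a smooth two-sided local inverse. -/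
lemma exists_localInverse [FiniteDimensional ℝ E] {f : M → N} {x : M}
    (hf : ∀ᶠ x' in 𝓝 x, ContMDiffAt 𝓘(ℝ, E) 𝓘(ℝ, F) ∞ f x')
    (hs : Function.Bijective (mfderiv 𝓘(ℝ, E) 𝓘(ℝ, F) f x)) :
    ∃ s : N → M, s (f x) = x ∧
      (∀ᶠ y in 𝓝 (f x), ContMDiffAt 𝓘(ℝ, F) 𝓘(ℝ, E) ∞ s y ∧ f (s y) = y) ∧
      ∀ᶠ z in 𝓝 x, s (f z) = z := by
  obtain ⟨s, hsx, h⟩ := exists_localSection hf hs.2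
  refine ⟨s, hsx, h, ?_⟩
  have hs1 := h.mono fun y hy => hy.1
  have hfx := hf.self_of_nhds.mdifferentiableAt (by simp)
  have hsd : MDifferentiableAt 𝓘(ℝ, F) 𝓘(ℝ, E) s (f x) :=
    hs1.self_of_nhds.mdifferentiableAt (by simp)
  have hcomp : (mfderiv 𝓘(ℝ, E) 𝓘(ℝ, F) f x).comp (mfderiv 𝓘(ℝ, F) 𝓘(ℝ, E) s (f x)) =
      ContinuousLinearMap.id ℝ _ := by
    have hfx' : MDifferentiableAt 𝓘(ℝ, E) 𝓘(ℝ, F) f (s (f x)) := by rwa [hsx]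
    have h1 := mfderiv_comp (f x) hfx' hsd
    have h2 : f ∘ s =ᶠ[𝓝 (f x)] id := h.mono fun y hy => hy.2
    rw [h2.mfderiv_eq, mfderiv_id, hsx] at h1
    exact h1.symm
  have hss : Function.Surjective (mfderiv 𝓘(ℝ, F) 𝓘(ℝ, E) s (f x)) := by
    intro v
    refine ⟨mfderiv 𝓘(ℝ, E) 𝓘(ℝ, F) f x v, hs.1 ?_⟩
    exact DFunLike.congr_fun hcomp _
  -- The section `s` is itself a submersion, with a section `t`. Near `x` this gives `f = f ∘ s ∘ t
  -- = t`, hence `s ∘ f = s ∘ t = id`.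
  obtain ⟨t, htx, ht⟩ := exists_localSection hs1 hss
  rw [hsx] at htx ht
  have htc := ht.self_of_nhds.1.continuousAt
  rw [ContinuousAt, htx] at htc
  filter_upwards [ht, htc.eventually h] with z hz hz'
  have h1 : f z = t z := by rw [← hz'.2, hz.2]
  rw [h1, hz.2]

end InverseFunction

/-! ### Tangent spaces and dimensions of orbits -/

section OrbitDerivative

variable {A E : Type*} [NormedAddCommGroup A] [NormedSpace ℝ A]
  [NormedAddCommGroup E] [NormedSpace ℝ E]
  {M : Type*} [TopologicalSpace M] [ChartedSpace E M] [IsManifold 𝓘(ℝ, E) ∞ M]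
  (G : Type*) [Group G] [TopologicalSpace G] [ChartedSpace A G] [LieGroup 𝓘(ℝ, A) ∞ G]
  [MulAction G M] [ContMDiffSMul 𝓘(ℝ, A) 𝓘(ℝ, E) ∞ G M]

/-- The derivative at `1` of the orbit map `g ↦ g • y`. -/
def orbitDeriv (y : M) : A →L[ℝ] E := mfderiv 𝓘(ℝ, A) 𝓘(ℝ, E) (fun g : G => g • y) 1

variable (A E) in
/-- The dimension of the orbit of `y`. -/
def orbitRank (y : M) : ℕ :=
  Module.finrank ℝ (LinearMap.range (orbitDeriv G y : A →L[ℝ] E).toLinearMap)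

variable {G}

lemma contMDiff_smul_const (y : M) : ContMDiff 𝓘(ℝ, A) 𝓘(ℝ, E) ∞ (fun g : G => g • y) :=
  contMDiff_id.smul contMDiff_const

lemma hasMFDerivAt_smul_const (y : M) :
    HasMFDerivAt 𝓘(ℝ, A) 𝓘(ℝ, E) (fun g : G => g • y) 1 (orbitDeriv G y : A →L[ℝ] E) :=
  ((contMDiff_smul_const y).mdifferentiable (by simp) 1).hasMFDerivAt

/-- The derivative of `z ↦ γ z • y` takes values in the tangent space of the orbit. -/
lemma exists_hasMFDerivAt_smul_curve {P : Type*} [NormedAddCommGroup P] [NormedSpace ℝ P]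
    {γ : P → G} {z : P} (hγ : ContMDiffAt 𝓘(ℝ, P) 𝓘(ℝ, A) ∞ γ z) (y : M) :
    ∃ D : P →L[ℝ] A, HasMFDerivAt 𝓘(ℝ, P) 𝓘(ℝ, E) (fun u => γ u • y) z
      ((orbitDeriv G (γ z • y) : A →L[ℝ] E).comp D) := by
  -- Writing `γ u • y = (γ u * (γ z)⁻¹) • (γ z • y)` makes the group element pass through `1`, where
  -- `orbitDeriv` is the derivative.
  have h1 : ContMDiffAt 𝓘(ℝ, P) 𝓘(ℝ, A) ∞ (fun u => γ u * (γ z)⁻¹) z :=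
    hγ.mul contMDiffAt_const
  have h2 := (h1.mdifferentiableAt (by simp)).hasMFDerivAt
  have h3 : HasMFDerivAt 𝓘(ℝ, A) 𝓘(ℝ, E) (fun g : G => g • (γ z • y)) (γ z * (γ z)⁻¹)
      (orbitDeriv G (γ z • y) : A →L[ℝ] E) := by
    rw [mul_inv_cancel]; exact hasMFDerivAt_smul_const _
  refine ⟨_, (h3.comp z h2).congr_of_eventuallyEq (Eventually.of_forall fun u => ?_)⟩
  simp [smul_smul]

/-- Since `u • g • y = g • (g⁻¹ * u * g) • y`, the orbit derivative at `g • y` factors through the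
one at `y`. -/
lemma orbitRank_smul_le [FiniteDimensional ℝ E] (g : G) (y : M) :
    orbitRank A E G (g • y) ≤ orbitRank A E G y := by
  have h1 : ContMDiff 𝓘(ℝ, A) 𝓘(ℝ, A) ∞ (fun u : G => g⁻¹ * u * g) :=
    (contMDiff_const.mul contMDiff_id).mul contMDiff_const
  have h2 := (h1.mdifferentiable (by simp) 1).hasMFDerivAt
  have h3 : HasMFDerivAt 𝓘(ℝ, A) 𝓘(ℝ, E) (fun g : G => g • y) (g⁻¹ * 1 * g)
      (orbitDeriv G y : A →L[ℝ] E) := by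
    rw [mul_one, inv_mul_cancel]; exact hasMFDerivAt_smul_const y
  have h4 : ContMDiff 𝓘(ℝ, E) 𝓘(ℝ, E) ∞ (fun y : M => g • y) :=
    ContMDiffSMul.contMDiff_const_smul (I := 𝓘(ℝ, A)) g
  have h5 := (h4.mdifferentiable (by simp) ((g⁻¹ * 1 * g) • y)).hasMFDerivAt
  have h6 := h5.comp 1 (h3.comp 1 h2)
  have h7 : HasMFDerivAt 𝓘(ℝ, A) 𝓘(ℝ, E) (fun u : G => u • (g • y)) 1 _ :=
    h6.congr_of_eventuallyEq (Eventually.of_forall fun u => by simp [smul_smul, mul_assoc])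
  have h8 : (orbitDeriv G (g • y) : A →L[ℝ] E) = _ := h7.mfderiv
  unfold orbitRank
  rw [h8]
  set L5 : E →L[ℝ] E := mfderiv 𝓘(ℝ, E) 𝓘(ℝ, E) (fun y : M => g • y) ((g⁻¹ * 1 * g) • y)
  set L2 : A →L[ℝ] A := mfderiv 𝓘(ℝ, A) 𝓘(ℝ, A) (fun u : G => g⁻¹ * u * g) 1
  have h9 : LinearMap.range ((L5.comp ((orbitDeriv G y : A →L[ℝ] E).comp L2)).toLinearMap) ≤
      (LinearMap.range (orbitDeriv G y : A →L[ℝ] E).toLinearMap).map L5.toLinearMap := by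
    rintro _ ⟨v, rfl⟩
    exact ⟨_, ⟨L2 v, rfl⟩, rfl⟩
  exact (Submodule.finrank_mono h9).trans (Submodule.finrank_map_le _ _)

lemma orbitRank_smul [FiniteDimensional ℝ E] (g : G) (y : M) :
    orbitRank A E G (g • y) = orbitRank A E G y := by
  refine le_antisymm (orbitRank_smul_le g y) ?_
  simpa using orbitRank_smul_le g⁻¹ (g • y)

/-- A smooth local parametrization centred at a given point. -/
lemma exists_localParametrization [FiniteDimensional ℝ E] (x : M) :
    ∃ e : E → M, e 0 = x ∧ (∀ᶠ u in 𝓝 0, ContMDiffAt 𝓘(ℝ, E) 𝓘(ℝ, E) ∞ e u) ∧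
      Function.Bijective (mfderiv 𝓘(ℝ, E) 𝓘(ℝ, E) e 0) := by
  set φ := extChartAt 𝓘(ℝ, E) x
  have hsm : ∀ᶠ u in 𝓝 (φ x), ContMDiffAt 𝓘(ℝ, E) 𝓘(ℝ, E) ∞ φ.symm u := by
    filter_upwards [eventually_mem_nhds_iff.2 (extChartAt_target_mem_nhds x)] with u hu
    exact (contMDiffOn_extChartAt_symm x).contMDiffAt hu
  have htr : Tendsto (fun u => φ x + u) (𝓝 0) (𝓝 (φ x)) := by
    have : Continuous fun u => φ x + u := by fun_prop
    simpa using this.tendsto 0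
  have hx : φ.symm (φ x) = x := extChartAt_to_inv x
  have htr' : ∀ u, ContMDiffAt 𝓘(ℝ, E) 𝓘(ℝ, E) ∞ (fun u => φ x + u) u := fun u =>
    (contDiff_const.add contDiff_id).contMDiff u
  have hsmooth : ∀ᶠ u in 𝓝 (0 : E), ContMDiffAt 𝓘(ℝ, E) 𝓘(ℝ, E) ∞ (fun u => φ.symm (φ x + u)) u := by
    filter_upwards [htr.eventually hsm] with u hu
    exact hu.comp u (htr' u)
  refine ⟨fun u => φ.symm (φ x + u), by simpa using hx, hsmooth, ?_⟩
  set e : E → M := fun u => φ.symm (φ x + u) with he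
  have he0 : e 0 = x := by simpa [he] using hx
  have hinv : (fun u => φ (e u)) =ᶠ[𝓝 0] fun u => φ x + u := by
    filter_upwards [htr.eventually (extChartAt_target_mem_nhds x)] with u hu
    exact φ.right_inv hu
  have hφd : MDifferentiableAt 𝓘(ℝ, E) 𝓘(ℝ, E) φ (e 0) := by
    rw [he0]; exact (contMDiffAt_extChartAt (n := ∞)).mdifferentiableAt (by simp)
  have h1 := hφd.hasMFDerivAt.comp 0
    (hsmooth.self_of_nhds.mdifferentiableAt (by simp)).hasMFDerivAt
  have h2 : HasMFDerivAt 𝓘(ℝ, E) 𝓘(ℝ, E) (fun u => φ x + u) 0 (ContinuousLinearMap.id ℝ E) :=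
    ((hasFDerivAt_id (0 : E)).const_add (φ x)).hasMFDerivAt
  have h3 := hasMFDerivAt_unique (h2.congr_of_eventuallyEq hinv) h1
  set L : E →L[ℝ] E := mfderiv 𝓘(ℝ, E) 𝓘(ℝ, E) e 0
  have hinj : Function.Injective L := by
    have : Function.LeftInverse (mfderiv 𝓘(ℝ, E) 𝓘(ℝ, E) φ (e 0)) L := fun v =>
      (DFunLike.congr_fun h3 v).symm
    exact this.injective
  exact ⟨hinj, LinearMap.injective_iff_surjective (f := L.toLinearMap) |>.1 hinj⟩

end OrbitDerivative

/-- Complements of the kernel and of the range of a linear map, as parametrized subspaces. -/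
lemma exists_complementary_parametrizations {A E : Type*} [NormedAddCommGroup A] [NormedSpace ℝ A]
    [NormedAddCommGroup E] [NormedSpace ℝ E] [FiniteDimensional ℝ E]
    (T : A →L[ℝ] E) (B : E →L[ℝ] E) (hB : Function.Bijective B) {r d : ℕ}
    (hr : Module.finrank ℝ (LinearMap.range T.toLinearMap) = r)
    (hd : r + d = Module.finrank ℝ E) :
    ∃ (j : EuclideanSpace ℝ (Fin r) →L[ℝ] A) (ι : EuclideanSpace ℝ (Fin d) →L[ℝ] E),
      Function.Bijective fun z : EuclideanSpace ℝ (Fin r) × EuclideanSpace ℝ (Fin d) =>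
        T (j z.1) + B (ι z.2) := by
  obtain ⟨D, hD⟩ := Submodule.exists_isCompl (LinearMap.range T.toLinearMap)
  have hDd : Module.finrank ℝ D = d := by
    have := Submodule.finrank_add_eq_of_isCompl hD
    omega
  let i1 : EuclideanSpace ℝ (Fin r) ≃ₗ[ℝ] LinearMap.range T.toLinearMap :=
    LinearEquiv.ofFinrankEq _ _ (by simp [hr])
  let i2 : EuclideanSpace ℝ (Fin d) ≃ₗ[ℝ] D :=
    LinearEquiv.ofFinrankEq _ _ (by simp [hDd])
  obtain ⟨ρ, hρ⟩ := T.toLinearMap.rangeRestrict.exists_rightInverse_of_surjective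
    T.toLinearMap.range_rangeRestrict
  let B' : E ≃ₗ[ℝ] E := LinearEquiv.ofBijective B.toLinearMap hB
  -- `j` lifts the range of `T` to `A` and `ι` pulls a complement `D` of that range back through
  -- `B`; the map then becomes the isomorphism `range T × D ≃ E`.
  refine ⟨(ρ ∘ₗ i1.toLinearMap).toContinuousLinearMap,
    (B'.symm.toLinearMap ∘ₗ D.subtype ∘ₗ i2.toLinearMap).toContinuousLinearMap, ?_⟩
  have key : (fun z : EuclideanSpace ℝ (Fin r) × EuclideanSpace ℝ (Fin d) =>
      T ((ρ ∘ₗ i1.toLinearMap).toContinuousLinearMap z.1) +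
        B ((B'.symm.toLinearMap ∘ₗ D.subtype ∘ₗ i2.toLinearMap).toContinuousLinearMap z.2)) =
      fun z => Submodule.prodEquivOfIsCompl _ _ hD (i1 z.1, i2 z.2) := by
    funext z
    have h1 : T (ρ (i1 z.1)) = i1 z.1 := congrArg Subtype.val (LinearMap.congr_fun hρ (i1 z.1))
    have h2 : B (B'.symm (i2 z.2)) = i2 z.2 := B'.apply_symm_apply _
    simp [h1, h2]
  rw [key]
  exact (Submodule.prodEquivOfIsCompl _ _ hD).bijective.comp
    (i1.bijective.prodMap i2.bijective)

/-! ### Coordinates along and across an orbit -/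

section OrbitCoordinates

variable (A E : Type*) [NormedAddCommGroup A] [NormedSpace ℝ A]
  [NormedAddCommGroup E] [NormedSpace ℝ E]
  {M : Type*} [TopologicalSpace M] [ChartedSpace E M]
  (G : Type*) [Group G] [TopologicalSpace G] [ChartedSpace A G] [MulAction G M]

/-- Coordinates near `x`: every point near `x` is uniquely of the form `e (j a) • σ c`, where
`e` parametrizes a neighbourhood of `1` in `G`, the map `a ↦ e (j a) • x` parametrizes the orbit
of `x` to first order, and `σ` parametrizes a transversal through `x`. -/
structure OrbitCoordinates (x : M) (r d : ℕ) where
  e : A → G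
  j : EuclideanSpace ℝ (Fin r) →L[ℝ] A
  σ : EuclideanSpace ℝ (Fin d) → M
  coord : M → EuclideanSpace ℝ (Fin r) × EuclideanSpace ℝ (Fin d)
  e_zero : e 0 = 1
  σ_zero : σ 0 = x
  coord_self : coord x = 0
  smooth_e : ∀ᶠ u in 𝓝 0, ContMDiffAt 𝓘(ℝ, A) 𝓘(ℝ, A) ∞ e u
  bijective_e : Function.Bijective (mfderiv 𝓘(ℝ, A) 𝓘(ℝ, A) e 0)
  smooth_coord : ∀ᶠ y in 𝓝 x, ContMDiffAt 𝓘(ℝ, E)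
    𝓘(ℝ, EuclideanSpace ℝ (Fin r) × EuclideanSpace ℝ (Fin d)) ∞ coord y
  surjective_mfderiv_coord : ∀ᶠ y in 𝓝 x, Function.Surjective (mfderiv 𝓘(ℝ, E)
    𝓘(ℝ, EuclideanSpace ℝ (Fin r) × EuclideanSpace ℝ (Fin d)) coord y)
  smul_coord : ∀ᶠ y in 𝓝 x, e (j (coord y).1) • σ (coord y).2 = y
  coord_smul : ∀ᶠ z in 𝓝 0, coord (e (j z.1) • σ z.2) = z

variable {A E} [IsManifold 𝓘(ℝ, E) ∞ M] [LieGroup 𝓘(ℝ, A) ∞ G]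
  [ContMDiffSMul 𝓘(ℝ, A) 𝓘(ℝ, E) ∞ G M] [FiniteDimensional ℝ A] [FiniteDimensional ℝ E]

/-- This is the inverse function theorem for `(a, c) ↦ e (j a) • σ c`. The stabilizer of `x` plays
no role: `σ` is only transverse to the orbit, not an invariant slice. -/
lemma nonempty_orbitCoordinates (x : M) {r d : ℕ} (hr : orbitRank A E G x = r)
    (hd : r + d = Module.finrank ℝ E) : Nonempty (OrbitCoordinates A E G x r d) := by
  have : IsManifold 𝓘(ℝ, A) ∞ G := inferInstance
  obtain ⟨e, he0, he, heb⟩ := exists_localParametrization (E := A) (1 : G)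
  obtain ⟨ε, hε0, hε, hεb⟩ := exists_localParametrization (E := E) x
  set De : A →L[ℝ] A := mfderiv 𝓘(ℝ, A) 𝓘(ℝ, A) e 0
  set Dε : E →L[ℝ] E := mfderiv 𝓘(ℝ, E) 𝓘(ℝ, E) ε 0
  set T : A →L[ℝ] E := (orbitDeriv G x : A →L[ℝ] E).comp De with hT
  have hTr : Module.finrank ℝ (LinearMap.range T.toLinearMap) = r := by
    have h1 : LinearMap.range T.toLinearMap =
        LinearMap.range (orbitDeriv G x : A →L[ℝ] E).toLinearMap :=
      LinearMap.range_comp_of_range_eq_top _ (LinearMap.range_eq_top.2 heb.2)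
    rw [h1]; exact hr
  obtain ⟨j, ι, hbij⟩ := exists_complementary_parametrizations T Dε hεb hTr hd
  set σ : EuclideanSpace ℝ (Fin d) → M := fun c => ε (ι c) with hσ
  set Ψ : EuclideanSpace ℝ (Fin r) × EuclideanSpace ℝ (Fin d) → M :=
    fun z => e (j z.1) • σ z.2 with hΨ
  have hj0 : Tendsto (fun z : EuclideanSpace ℝ (Fin r) × EuclideanSpace ℝ (Fin d) => j z.1)
      (𝓝 0) (𝓝 0) := by
    have : Continuous fun z : EuclideanSpace ℝ (Fin r) × EuclideanSpace ℝ (Fin d) => j z.1 := by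
      fun_prop
    simpa using this.tendsto 0
  have hι0 : Tendsto (fun z : EuclideanSpace ℝ (Fin r) × EuclideanSpace ℝ (Fin d) => ι z.2)
      (𝓝 0) (𝓝 0) := by
    have : Continuous fun z : EuclideanSpace ℝ (Fin r) × EuclideanSpace ℝ (Fin d) => ι z.2 := by
      fun_prop
    simpa using this.tendsto 0
  have hΨs : ∀ᶠ z in 𝓝 0, ContMDiffAt
      𝓘(ℝ, EuclideanSpace ℝ (Fin r) × EuclideanSpace ℝ (Fin d)) 𝓘(ℝ, E) ∞ Ψ z := by
    filter_upwards [hj0.eventually he, hι0.eventually hε] with z h1 h2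
    have h3 : ContMDiffAt 𝓘(ℝ, EuclideanSpace ℝ (Fin r) × EuclideanSpace ℝ (Fin d)) 𝓘(ℝ, A) ∞
        (fun z => j z.1) z := by
      have : ContDiff ℝ ∞ fun z : EuclideanSpace ℝ (Fin r) × EuclideanSpace ℝ (Fin d) => j z.1 := by
        fun_prop
      exact this.contMDiff z
    have h4 : ContMDiffAt 𝓘(ℝ, EuclideanSpace ℝ (Fin r) × EuclideanSpace ℝ (Fin d)) 𝓘(ℝ, E) ∞
        (fun z => ι z.2) z := by
      have : ContDiff ℝ ∞ fun z : EuclideanSpace ℝ (Fin r) × EuclideanSpace ℝ (Fin d) => ι z.2 := by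
        fun_prop
      exact this.contMDiff z
    exact (ContMDiffAt.comp z h1 h3).smul (ContMDiffAt.comp z h2 h4)
  have hΨ0 : Ψ 0 = x := by simp [hΨ, hσ, he0, hε0]
  have hσ0 : σ 0 = x := by simp [hσ, hε0]
  have hΨd := (hΨs.self_of_nhds.mdifferentiableAt (by simp)).hasMFDerivAt
  set D : EuclideanSpace ℝ (Fin r) × EuclideanSpace ℝ (Fin d) →L[ℝ] E :=
    mfderiv 𝓘(ℝ, EuclideanSpace ℝ (Fin r) × EuclideanSpace ℝ (Fin d)) 𝓘(ℝ, E) Ψ 0 with hD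
  have heD : HasMFDerivAt 𝓘(ℝ, A) 𝓘(ℝ, A) e 0 De :=
    (he.self_of_nhds.mdifferentiableAt (by simp)).hasMFDerivAt
  have hεD : HasMFDerivAt 𝓘(ℝ, E) 𝓘(ℝ, E) ε 0 Dε :=
    (hε.self_of_nhds.mdifferentiableAt (by simp)).hasMFDerivAt
  have hDl : D.comp (ContinuousLinearMap.inl ℝ _ _) = T.comp j := by
    have h1 : HasMFDerivAt 𝓘(ℝ, EuclideanSpace ℝ (Fin r))
        𝓘(ℝ, EuclideanSpace ℝ (Fin r) × EuclideanSpace ℝ (Fin d))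
        (fun a : EuclideanSpace ℝ (Fin r) => (a, (0 : EuclideanSpace ℝ (Fin d)))) 0
        (ContinuousLinearMap.inl ℝ (EuclideanSpace ℝ (Fin r)) (EuclideanSpace ℝ (Fin d))) :=
      (ContinuousLinearMap.inl ℝ (EuclideanSpace ℝ (Fin r))
        (EuclideanSpace ℝ (Fin d))).hasFDerivAt.hasMFDerivAt
    have h2 := HasMFDerivAt.comp (g := Ψ) (0 : EuclideanSpace ℝ (Fin r)) hΨd h1
    have h3 : HasMFDerivAt 𝓘(ℝ, EuclideanSpace ℝ (Fin r)) 𝓘(ℝ, A) (fun a => j a) 0 j :=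
      j.hasFDerivAt.hasMFDerivAt
    have h4 : HasMFDerivAt 𝓘(ℝ, A) 𝓘(ℝ, A) e (j 0) De := by rw [map_zero]; exact heD
    have h5 : HasMFDerivAt 𝓘(ℝ, A) 𝓘(ℝ, E) (fun g : G => g • x) (e (j 0))
        (orbitDeriv G x : A →L[ℝ] E) := by
      rw [map_zero, he0]; exact hasMFDerivAt_smul_const x
    have h6 := HasMFDerivAt.comp (0 : EuclideanSpace ℝ (Fin r)) h5
      (HasMFDerivAt.comp (0 : EuclideanSpace ℝ (Fin r)) h4 h3)
    refine hasMFDerivAt_unique h2 (h6.congr_of_eventuallyEq (Eventually.of_forall fun a => ?_))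
    simp [hΨ, hσ0]
  have hDr : D.comp (ContinuousLinearMap.inr ℝ _ _) = Dε.comp ι := by
    have h1 : HasMFDerivAt 𝓘(ℝ, EuclideanSpace ℝ (Fin d))
        𝓘(ℝ, EuclideanSpace ℝ (Fin r) × EuclideanSpace ℝ (Fin d))
        (fun c : EuclideanSpace ℝ (Fin d) => ((0 : EuclideanSpace ℝ (Fin r)), c)) 0
        (ContinuousLinearMap.inr ℝ (EuclideanSpace ℝ (Fin r)) (EuclideanSpace ℝ (Fin d))) :=
      (ContinuousLinearMap.inr ℝ (EuclideanSpace ℝ (Fin r))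
        (EuclideanSpace ℝ (Fin d))).hasFDerivAt.hasMFDerivAt
    have h2 := HasMFDerivAt.comp (g := Ψ) (0 : EuclideanSpace ℝ (Fin d)) hΨd h1
    have h3 : HasMFDerivAt 𝓘(ℝ, EuclideanSpace ℝ (Fin d)) 𝓘(ℝ, E) (fun a => ι a) 0 ι :=
      ι.hasFDerivAt.hasMFDerivAt
    have h4 : HasMFDerivAt 𝓘(ℝ, E) 𝓘(ℝ, E) ε (ι 0) Dε := by rw [map_zero]; exact hεD
    have h6 := HasMFDerivAt.comp (0 : EuclideanSpace ℝ (Fin d)) h4 h3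
    refine hasMFDerivAt_unique h2 (h6.congr_of_eventuallyEq (Eventually.of_forall fun a => ?_))
    simp [hΨ, he0, hσ]
  have hDbij : Function.Bijective D := by
    convert hbij using 2 with z
    have h1 := DFunLike.congr_fun hDl z.1
    have h2 := DFunLike.congr_fun hDr z.2
    rw [← show T (j z.1) = T.comp j z.1 from rfl] at h1
    have h3 : z = ContinuousLinearMap.inl ℝ _ _ z.1 + ContinuousLinearMap.inr ℝ _ _ z.2 := by
      simp
    conv_lhs => rw [h3, map_add]
    exact congrArg₂ (· + ·) h1 h2
  obtain ⟨s, hs0, hs1, hs2⟩ := exists_localInverse hΨs hDbij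
  rw [hΨ0] at hs0 hs1
  have hst : Tendsto s (𝓝 x) (𝓝 0) := by
    have := hs1.self_of_nhds.1.continuousAt.tendsto
    rwa [hs0] at this
  have hsurj : ∀ᶠ y in 𝓝 x, Function.Surjective (mfderiv 𝓘(ℝ, E)
      𝓘(ℝ, EuclideanSpace ℝ (Fin r) × EuclideanSpace ℝ (Fin d)) s y) := by
    filter_upwards [hs1, hst.eventually hs2.eventually_nhds, hst.eventually hΨs] with y h1 h2 h3
    have h4 : MDifferentiableAt 𝓘(ℝ, E)
        𝓘(ℝ, EuclideanSpace ℝ (Fin r) × EuclideanSpace ℝ (Fin d)) s (Ψ (s y)) := by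
      rw [h1.2]; exact h1.1.mdifferentiableAt (by simp)
    have h5 := h4.hasMFDerivAt.comp (s y) (h3.mdifferentiableAt (by simp)).hasMFDerivAt
    have h6 := hasMFDerivAt_unique h5 ((hasMFDerivAt_id (s y)).congr_of_eventuallyEq h2)
    rw [h1.2] at h6
    exact fun v => ⟨_, DFunLike.congr_fun h6 v⟩
  exact ⟨⟨e, j, σ, s, he0, hσ0, hs0, he, heb, hs1.mono fun y hy => hy.1, hsurj,
    hs1.mono fun y hy => hy.2, hs2⟩⟩

end OrbitCoordinates

/-! ### Local invariance of the transversal coordinate; orbit type determines orbit dimension -/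

section OrbitCoordinates

variable {A E : Type*} [NormedAddCommGroup A] [NormedSpace ℝ A]
  [NormedAddCommGroup E] [NormedSpace ℝ E]
  {M : Type*} [TopologicalSpace M] [ChartedSpace E M]
  {G : Type*} [Group G] [TopologicalSpace G] [ChartedSpace A G] [MulAction G M]
  [IsManifold 𝓘(ℝ, E) ∞ M] [LieGroup 𝓘(ℝ, A) ∞ G]
  [ContMDiffSMul 𝓘(ℝ, A) 𝓘(ℝ, E) ∞ G M] [FiniteDimensional ℝ A] [FiniteDimensional ℝ E]

namespace OrbitCoordinates

variable {x : M} {r d : ℕ} (c : OrbitCoordinates A E G x r d)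

/-- The derivative of the coordinate map. -/
def coordDeriv (y : M) : E →L[ℝ] EuclideanSpace ℝ (Fin r) × EuclideanSpace ℝ (Fin d) :=
  mfderiv 𝓘(ℝ, E) 𝓘(ℝ, EuclideanSpace ℝ (Fin r) × EuclideanSpace ℝ (Fin d)) c.coord y

lemma tendsto_coord : Tendsto c.coord (𝓝 x) (𝓝 0) := by
  have := c.smooth_coord.self_of_nhds.continuousAt.tendsto
  rwa [c.coord_self] at this

lemma tendsto_e : Tendsto c.e (𝓝 0) (𝓝 1) := by
  have := c.smooth_e.self_of_nhds.continuousAt.tendsto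
  rwa [c.e_zero] at this

lemma tendsto_j : Tendsto c.j (𝓝 0) (𝓝 0) := by
  simpa using c.j.continuous.tendsto 0

/-- Near `x`, the orbit of `y` contains the slice `{z | (coord z).2 = (coord y).2}` to first
order. -/
lemma eventually_exists_comp : ∀ᶠ y in 𝓝 x, ∃ D : EuclideanSpace ℝ (Fin r) →L[ℝ] A,
    (c.coordDeriv y).comp ((orbitDeriv G y : A →L[ℝ] E).comp D) =
      ContinuousLinearMap.inl ℝ (EuclideanSpace ℝ (Fin r)) (EuclideanSpace ℝ (Fin d)) := by
  have hfst : Tendsto (fun y => c.j (c.coord y).1) (𝓝 x) (𝓝 0) :=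
    c.tendsto_j.comp ((continuous_fst.tendsto _).comp c.tendsto_coord)
  filter_upwards [c.smooth_coord, c.smul_coord, hfst.eventually c.smooth_e,
    c.tendsto_coord.eventually c.coord_smul.eventually_nhds] with y h1 h2 h3 h4
  set a := (c.coord y).1
  set b := (c.coord y).2
  -- The family `u ↦ e (j u) • σ b` stays in the orbit of `y` and has coordinates `(u, b)`;
  -- differentiating at `u = a` gives the claim.
  have h5 : ContMDiffAt 𝓘(ℝ, EuclideanSpace ℝ (Fin r)) 𝓘(ℝ, A) ∞ (fun u => c.e (c.j u)) a :=
    h3.comp a c.j.contDiff.contMDiff.contMDiffAt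
  obtain ⟨D, hD⟩ := exists_hasMFDerivAt_smul_curve (E := E) h5 (c.σ b)
  rw [h2] at hD
  refine ⟨D, ?_⟩
  have h6 : HasMFDerivAt 𝓘(ℝ, E) 𝓘(ℝ, EuclideanSpace ℝ (Fin r) × EuclideanSpace ℝ (Fin d))
      c.coord (c.e (c.j a) • c.σ b) (c.coordDeriv y) := by
    rw [h2]; exact (h1.mdifferentiableAt (by simp)).hasMFDerivAt
  have h7 := HasMFDerivAt.comp a h6 hD
  have h8 : HasMFDerivAt 𝓘(ℝ, EuclideanSpace ℝ (Fin r))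
      𝓘(ℝ, EuclideanSpace ℝ (Fin r) × EuclideanSpace ℝ (Fin d))
      (fun u : EuclideanSpace ℝ (Fin r) => (u, b)) a
      (ContinuousLinearMap.inl ℝ (EuclideanSpace ℝ (Fin r)) (EuclideanSpace ℝ (Fin d))) :=
    (hasFDerivAt_prodMk_left a b).hasMFDerivAt
  have h9 : (fun u => (u, b)) =ᶠ[𝓝 a] c.coord ∘ fun u => c.e (c.j u) • c.σ b := by
    have : Tendsto (fun u : EuclideanSpace ℝ (Fin r) => (u, b)) (𝓝 a) (𝓝 (c.coord y)) :=
      (Continuous.prodMk_left b).tendsto a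
    filter_upwards [this.eventually h4] with u hu
    exact hu.symm
  exact hasMFDerivAt_unique h7 (h8.congr_of_eventuallyEq h9.symm)

/-- Near `x` the tangent space of an orbit contains an `r`-dimensional subspace on which the
transversal coordinate has derivative zero. If the orbit has dimension at most `r`, this subspace is
the whole tangent space. -/
lemma eventually_coordDeriv_orbitDeriv : ∀ᶠ y in 𝓝 x, orbitRank A E G y ≤ r →
    ∀ v : A, (c.coordDeriv y ((orbitDeriv G y : A →L[ℝ] E) v)).2 = 0 := by
  filter_upwards [c.eventually_exists_comp] with y ⟨D, hD⟩ hr v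
  have hinj : Function.Injective ((orbitDeriv G y : A →L[ℝ] E).comp D) := by
    have h : Function.Injective ((c.coordDeriv y).comp ((orbitDeriv G y : A →L[ℝ] E).comp D)) := by
      rw [hD]; exact LinearMap.inl_injective
    exact Function.Injective.of_comp h
  have h1 := LinearMap.finrank_range_of_inj
    (f := ((orbitDeriv G y : A →L[ℝ] E).comp D).toLinearMap) hinj
  rw [finrank_euclideanSpace_fin] at h1
  have h2 := Submodule.eq_of_le_of_finrank_le (LinearMap.range_comp_le_range D.toLinearMap
    (orbitDeriv G y : A →L[ℝ] E).toLinearMap) (hr.trans h1.ge)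
  have h3 : (orbitDeriv G y : A →L[ℝ] E) v ∈
      LinearMap.range (orbitDeriv G y : A →L[ℝ] E).toLinearMap := ⟨v, rfl⟩
  rw [← h2] at h3
  obtain ⟨w, hw⟩ := h3
  have h4 : c.coordDeriv y ((orbitDeriv G y : A →L[ℝ] E) (D w)) = (w, 0) :=
    DFunLike.congr_fun hD w
  have h5 : (orbitDeriv G y : A →L[ℝ] E) (D w) = (orbitDeriv G y : A →L[ℝ] E) v := hw
  rw [← h5, h4]

/-- The transversal coordinate is locally invariant at points whose orbit has dimension `≤ r`. -/
lemma exists_eventually_coord_smul [ContinuousSMul G M] : ∃ U ∈ 𝓝 (1 : G), ∀ᶠ y in 𝓝 x,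
    orbitRank A E G y ≤ r → ∀ g ∈ U, (c.coord (g • y)).2 = (c.coord y).2 := by
  have hW := c.smooth_coord.and c.eventually_coordDeriv_orbitDeriv
  have hact : Tendsto (fun q : A × M => c.e q.1 • q.2) (𝓝 0 ×ˢ 𝓝 x) (𝓝 x) := by
    have h1 : Tendsto (fun q : A × M => c.e q.1 • q.2) (𝓝 0 ×ˢ 𝓝 x) (𝓝 ((1 : G) • x)) :=
      (c.tendsto_e.comp tendsto_fst).smul tendsto_snd
    rwa [one_smul] at h1
  -- A product neighbourhood provides one radius `ρ` in the group parameter that serves all `y` near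
  -- `x`.
  obtain ⟨pa, hpa, pb, hpb, hprod⟩ := eventually_prod_iff.1 (hact.eventually hW)
  obtain ⟨ρ, hρ, hball⟩ := Metric.eventually_nhds_iff_ball.1 (hpa.and c.smooth_e)
  refine ⟨c.e '' Metric.ball 0 ρ, ?_, ?_⟩
  · have : IsManifold 𝓘(ℝ, A) ∞ G := inferInstance
    have := image_mem_nhds_of_surjective_mfderiv c.smooth_e c.bijective_e.2
      (Metric.ball_mem_nhds (0 : A) hρ)
    rwa [c.e_zero] at this
  · filter_upwards [hpb] with y hy hr
    rintro _ ⟨a, ha, rfl⟩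
    -- The derivative of `u ↦ e u • y` takes values in the tangent space of the orbit, whose
    -- dimension at `e u • y` is the same as at `y`; the transversal coordinate is therefore
    -- constant on the connected ball.
    have hder : ∀ u ∈ Metric.ball (0 : A) ρ,
        HasFDerivAt (fun u => (c.coord (c.e u • y)).2) (0 : A →L[ℝ] _) u := by
      intro u hu
      obtain ⟨D, hD⟩ := exists_hasMFDerivAt_smul_curve (E := E) (hball u hu).2 y
      obtain ⟨h1, h2⟩ := hprod (hball u hu).1 hy
      have h3 : HasMFDerivAt 𝓘(ℝ, E) 𝓘(ℝ, EuclideanSpace ℝ (Fin r) × EuclideanSpace ℝ (Fin d))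
          c.coord (c.e u • y) (c.coordDeriv (c.e u • y)) :=
        (h1.mdifferentiableAt (by simp)).hasMFDerivAt
      have h4 : HasFDerivAt (fun u => c.coord (c.e u • y)) _ u :=
        (HasMFDerivAt.comp u h3 hD).hasFDerivAt
      have h5 := hasFDerivAt_snd.comp u h4
      have h6 : (ContinuousLinearMap.snd ℝ (EuclideanSpace ℝ (Fin r))
          (EuclideanSpace ℝ (Fin d))).comp ((c.coordDeriv (c.e u • y)).comp
            ((orbitDeriv G (c.e u • y) : A →L[ℝ] E).comp D)) = 0 := by
        ext1 v
        exact h2 (by rw [orbitRank_smul]; exact hr) (D v)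
      rw [← h6]
      exact h5
    have := Metric.isOpen_ball.is_const_of_fderiv_eq_zero (𝕜 := ℝ)
      (convex_ball (0 : A) ρ).isPreconnected
      (fun u hu => (hder u hu).differentiableAt.differentiableWithinAt)
      (fun u hu => (hder u hu).fderiv) ha (Metric.mem_ball_self hρ)
    simpa [c.e_zero] using this

end OrbitCoordinates

lemma exists_nonempty_orbitCoordinates (x : M) : Nonempty (OrbitCoordinates A E G x
    (orbitRank A E G x) (Module.finrank ℝ E - orbitRank A E G x)) := by
  refine nonempty_orbitCoordinates G x rfl ?_
  have : orbitRank A E G x ≤ Module.finrank ℝ E := Submodule.finrank_le _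
  omega

/-- A larger stabilizer means a smaller orbit. -/
lemma orbitRank_le_of_stabilizer_le [ContinuousSMul G M] {x z : M}
    (h : stabilizer G x ≤ stabilizer G z) : orbitRank A E G z ≤ orbitRank A E G x := by
  obtain ⟨c⟩ := exists_nonempty_orbitCoordinates (A := A) (E := E) (G := G) x
  obtain ⟨U, hU, hinv⟩ := c.exists_eventually_coord_smul
  have hx := hinv.self_of_nhds le_rfl
  have hex : Tendsto (fun a => c.e a • x) (𝓝 0) (𝓝 x) := by
    have := c.tendsto_e.smul_const x
    rwa [one_smul] at this
  set De : A →L[ℝ] A := mfderiv 𝓘(ℝ, A) 𝓘(ℝ, A) c.e 0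
  have heD : HasMFDerivAt 𝓘(ℝ, A) 𝓘(ℝ, A) c.e 0 De :=
    (c.smooth_e.self_of_nhds.mdifferentiableAt (by simp)).hasMFDerivAt
  have hcD : HasMFDerivAt 𝓘(ℝ, E) 𝓘(ℝ, EuclideanSpace ℝ (Fin _) × EuclideanSpace ℝ (Fin _)) c.coord x (c.coordDeriv x) :=
    (c.smooth_coord.self_of_nhds.mdifferentiableAt (by simp)).hasMFDerivAt
  have hθ : ∀ y : M, HasMFDerivAt 𝓘(ℝ, A) 𝓘(ℝ, E) (fun a => c.e a • y) 0
      ((orbitDeriv G y : A →L[ℝ] E).comp De) := by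
    intro y
    refine HasMFDerivAt.comp (g := fun g : G => g • y) (0 : A) ?_ heD
    rw [c.e_zero]; exact hasMFDerivAt_smul_const y
  -- Along the orbit of `x` the transversal coordinate remains `0` near `x`, so `e a • x = e (β a) •
  -- x` for small `a`. Then `(e (β a))⁻¹ * e a` fixes `x`, hence also `z`.
  set β : A → A := fun a => c.j (c.coord (c.e a • x)).1 with hβ
  have hβ0 : β 0 = 0 := by simp [hβ, c.e_zero, c.coord_self]
  have hβD : HasMFDerivAt 𝓘(ℝ, A) 𝓘(ℝ, A) β 0
      ((c.j.comp ((ContinuousLinearMap.fst ℝ _ _).comp (c.coordDeriv x))).comp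
        ((orbitDeriv G x : A →L[ℝ] E).comp De)) := by
    have h1 : HasMFDerivAt 𝓘(ℝ, E) 𝓘(ℝ, EuclideanSpace ℝ (Fin _) × EuclideanSpace ℝ (Fin _)) c.coord (c.e 0 • x) (c.coordDeriv x) := by
      rw [c.e_zero, one_smul]; exact hcD
    have h2 : HasFDerivAt (fun a => c.coord (c.e a • x)) _ 0 :=
      (HasMFDerivAt.comp (0 : A) h1 (hθ x)).hasFDerivAt
    exact (c.j.hasFDerivAt.comp (0 : A) (hasFDerivAt_fst.comp (0 : A) h2)).hasMFDerivAt
  have heq : (fun a => c.e a • z) =ᶠ[𝓝 0] fun a => c.e (β a) • z := by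
    filter_upwards [c.tendsto_e hU, hex.eventually c.smul_coord] with a ha hs
    rw [hx _ ha, c.coord_self] at hs
    have hs' : c.e (β a) • x = c.e a • x := by
      rw [← hs]
      simp only [Prod.snd_zero, c.σ_zero]
      rfl
    have h1 : (c.e (β a))⁻¹ * c.e a ∈ stabilizer G x := by
      rw [mem_stabilizer_iff, mul_smul, ← hs', inv_smul_smul]
    have h2 := h h1
    rw [mem_stabilizer_iff, mul_smul, inv_smul_eq_iff] at h2
    exact h2
  have h3 : HasMFDerivAt 𝓘(ℝ, A) 𝓘(ℝ, E) (fun a => c.e (β a) • z) 0 _ :=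
    HasMFDerivAt.comp (g := fun a => c.e a • z) (0 : A) (by rw [hβ0]; exact hθ z) hβD
  -- Differentiating `e a • z = e (β a) • z` at `0` factors the orbit derivative at `z` through the
  -- one at `x`. No Lie group structure on stabilizers is needed.
  have h4 := hasMFDerivAt_unique (hθ z) (h3.congr_of_eventuallyEq heq)
  have h5 : LinearMap.range (orbitDeriv G z : A →L[ℝ] E).toLinearMap ≤
      (LinearMap.range (orbitDeriv G x : A →L[ℝ] E).toLinearMap).map
        (((orbitDeriv G z : A →L[ℝ] E).comp De).comp
          (c.j.comp ((ContinuousLinearMap.fst ℝ _ _).comp (c.coordDeriv x)))).toLinearMap := by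
    rintro _ ⟨v, rfl⟩
    obtain ⟨w, rfl⟩ := c.bijective_e.2 v
    exact ⟨_, ⟨De w, rfl⟩, (DFunLike.congr_fun h4 w).symm⟩
  exact (Submodule.finrank_mono h5).trans (Submodule.finrank_map_le _ _)

/-- The dimension of an orbit depends only on its type. -/
lemma SameOrbitType.orbitRank_eq [ContinuousSMul G M] {x y : M} (h : SameOrbitType G x y) :
    orbitRank A E G y = orbitRank A E G x := by
  have key : ∀ {x y : M}, SameOrbitType G x y → orbitRank A E G y ≤ orbitRank A E G x := by
    rintro x y ⟨g, hg⟩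
    have h1 : stabilizer G (g • x) = stabilizer G y := by
      rw [hg, stabilizer_smul_eq_stabilizer_map_conj]
    rw [← orbitRank_smul g x]
    exact orbitRank_le_of_stabilizer_le h1.le
  exact le_antisymm (key h) (key (h.symm G))

end OrbitCoordinates

/-! ### Consequences of compactness of the group -/

section CompactGroup

variable {G M : Type*} [Group G] [TopologicalSpace G] [IsTopologicalGroup G] [CompactSpace G]
  [TopologicalSpace M] [T2Space M] [MulAction G M] [ContinuousSMul G M]

/-- A stabilizer in a compact group is not conjugate to a proper subgroup of itself. -/
lemma conj_inv_mem_stabilizer_of_conj_mem {x : M} {k : G}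
    (hk : ∀ h ∈ stabilizer G x, k * h * k⁻¹ ∈ stabilizer G x) {h : G} (hh : h ∈ stabilizer G x) :
    k⁻¹ * h * k ∈ stabilizer G x := by
  -- The elements conjugating the stabilizer into itself form a closed submonoid, and in a compact
  -- group `k⁻¹` lies in the closure of the powers `k ^ n`, `n : ℕ`.
  set S : Submonoid G :=
    { carrier := {k | ∀ h ∈ stabilizer G x, k * h * k⁻¹ ∈ stabilizer G x}
      one_mem' := by simp
      mul_mem' := by
        intro a b ha hb h hh
        have := ha _ (hb h hh)
        simpa [mul_assoc] using this }
  have hS : IsClosed (S : Set G) := by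
    have : (S : Set G) = ⋂ h ∈ stabilizer G x, {k : G | (k * h * k⁻¹) • x = x} := by
      ext a; simp [S, mem_stabilizer_iff]
    rw [this]
    refine isClosed_biInter fun h _ => isClosed_eq ?_ continuous_const
    fun_prop
  have h1 : k⁻¹ ∈ S := by
    have hkS : k ∈ S := hk
    have h2 : k⁻¹ ∈ closure (range (k ^ · : ℕ → G)) := by
      rw [← closure_range_zpow_eq_pow]
      exact subset_closure ⟨-1, by simp⟩
    exact closure_minimal (range_subset_iff.2 fun n => S.pow_mem hkS n) hS h2
  simpa using h1 h hh

/-- Stabilizers of the same type at points near `x` are conjugate to that of `x` by an element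
near `1`. -/
lemma eventually_exists_stabilizer_eq_conj (x : M) {U : Set G} (hU : U ∈ 𝓝 1) :
    ∀ᶠ y in 𝓝 x, SameOrbitType G x y → ∃ k ∈ U, ∀ h ∈ stabilizer G x, h • k⁻¹ • y = k⁻¹ • y := by
  -- By compactness it is enough to work near each `k`. If `k` conjugates the stabilizer into
  -- itself, take `n = k`. Otherwise some `k * h * k⁻¹` moves `x`, and this persists for nearby
  -- points and group elements, so the premise fails there.
  have key : ∀ᶠ y in 𝓝 x, ∀ k ∈ (univ : Set G), (∀ h ∈ stabilizer G x, (k * h * k⁻¹) • y = y) →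
      ∃ u ∈ U, ∃ n : G, (∀ h ∈ stabilizer G x, n⁻¹ * h * n ∈ stabilizer G x) ∧ k = u * n := by
    refine isCompact_univ.eventually_forall_of_forall_eventually fun k _ => ?_
    by_cases hk : ∀ h ∈ stabilizer G x, k * h * k⁻¹ ∈ stabilizer G x
    · have h1 : Tendsto (fun z : M × G => z.2 * k⁻¹) (𝓝 (x, k)) (𝓝 1) := by
        have : Continuous fun z : M × G => z.2 * k⁻¹ := by fun_prop
        simpa using this.tendsto (x, k)
      filter_upwards [h1 hU] with z hz _
      exact ⟨_, hz, k, fun h hh => conj_inv_mem_stabilizer_of_conj_mem hk hh, by simp⟩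
    · push Not at hk
      obtain ⟨h, hh, hne⟩ := hk
      have h1 : IsOpen {z : M × G | (z.2 * h * z.2⁻¹) • z.1 ≠ z.1} :=
        isOpen_ne_fun (by fun_prop) (by fun_prop)
      filter_upwards [h1.mem_nhds (by simpa [mem_stabilizer_iff] using hne)] with z hz hall
      exact absurd (hall h hh) hz
  filter_upwards [key] with y hy
  rintro ⟨k, hk⟩
  have hmem : ∀ h ∈ stabilizer G x, (k * h * k⁻¹) • y = y := fun h hh => by
    rw [← mem_stabilizer_iff, hk]
    exact ⟨h, hh, by simp⟩
  obtain ⟨u, hu, n, hn, rfl⟩ := hy k (mem_univ _) hmem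
  refine ⟨u, hu, fun h hh => ?_⟩
  -- With `k = u * n` one has `u * h * u⁻¹ = k * (n⁻¹ * h * n) * k⁻¹`, so the factor `u` near `1`
  -- can replace `k`.
  have := hmem _ (hn h hh)
  rw [show u * n * (n⁻¹ * h * n) * (u * n)⁻¹ = u * h * u⁻¹ by group, mul_smul, mul_smul] at this
  rw [eq_inv_smul_iff]
  exact this

/-- If `g` moves a point near `x` to a point near `x`, then `g` is near the stabilizer of `x`. -/
lemma eventually_exists_eq_mul_stabilizer (x : M) {U : Set G} (hU : U ∈ 𝓝 1) :
    ∀ᶠ p in 𝓝 (x, x), ∀ g : G, g • p.1 = p.2 → ∃ u ∈ U, ∃ h ∈ stabilizer G x, g = u * h := by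
  have key : ∀ᶠ p in 𝓝 (x, x), ∀ g ∈ (univ : Set G), g • p.1 = p.2 →
      ∃ u ∈ U, ∃ h ∈ stabilizer G x, g = u * h := by
    refine isCompact_univ.eventually_forall_of_forall_eventually fun g _ => ?_
    by_cases hg : g • x = x
    · have h1 : Tendsto (fun z : (M × M) × G => z.2 * g⁻¹) (𝓝 ((x, x), g)) (𝓝 1) := by
        have : Continuous fun z : (M × M) × G => z.2 * g⁻¹ := by fun_prop
        simpa using this.tendsto ((x, x), g)
      filter_upwards [h1 hU] with z hz _
      exact ⟨_, hz, g, hg, by simp⟩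
    · have h1 : IsOpen {z : (M × M) × G | z.2 • z.1.1 ≠ z.1.2} :=
        isOpen_ne_fun (by fun_prop) (by fun_prop)
      filter_upwards [h1.mem_nhds hg] with z hz h
      exact absurd h hz
  exact key.mono fun p hp g => hp g (mem_univ _)

/-- Neighbourhoods of `1` and of `x` contain neighbourhoods that are moved very little by the
stabilizer of `x`. -/
lemma eventually_conj_stabilizer_mem (x : M) {U : Set G} (hU : U ∈ 𝓝 1) :
    ∀ᶠ k in 𝓝 (1 : G), ∀ h ∈ stabilizer G x, h * k * h⁻¹ ∈ U := by
  have h1 : ∀ᶠ k in 𝓝 (1 : G), ∀ h ∈ (univ : Set G), h * k * h⁻¹ ∈ U := by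
    refine isCompact_univ.eventually_forall_of_forall_eventually fun h _ => ?_
    have : Continuous fun z : G × G => z.2 * z.1 * z.2⁻¹ := by fun_prop
    have := this.tendsto (1, h)
    simp only [mul_one, mul_inv_cancel] at this
    exact this hU
  exact h1.mono fun k hk h _ => hk h (mem_univ _)

lemma eventually_forall_stabilizer_smul {x : M} {p : M → Prop} (hp : ∀ᶠ y in 𝓝 x, p y) :
    ∀ᶠ y in 𝓝 x, ∀ h ∈ stabilizer G x, p (h • y) := by
  have hc : IsCompact (stabilizer G x : Set G) := by
    have : IsClosed {g : G | g • x = x} := isClosed_eq (by fun_prop) continuous_const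
    exact this.isCompact
  refine hc.eventually_forall_of_forall_eventually (P := fun y h => p (h • y)) fun h hh => ?_
  have : Continuous fun z : M × G => z.2 • z.1 := by fun_prop
  have := this.tendsto (x, h)
  rw [show h • x = x from hh] at this
  exact this.eventually hp

end CompactGroup

/-! ### The orbits near a regular point -/

section LocalQuotient

variable {A E : Type*} [NormedAddCommGroup A] [NormedSpace ℝ A]
  [NormedAddCommGroup E] [NormedSpace ℝ E]
  {M : Type*} [TopologicalSpace M] [ChartedSpace E M] [T2Space M]
  {G : Type*} [Group G] [TopologicalSpace G] [ChartedSpace A G] [MulAction G M]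
  [IsManifold 𝓘(ℝ, E) ∞ M] [LieGroup 𝓘(ℝ, A) ∞ G] [CompactSpace G] [ContinuousSMul G M]
  [ContMDiffSMul 𝓘(ℝ, A) 𝓘(ℝ, E) ∞ G M] [FiniteDimensional ℝ A] [FiniteDimensional ℝ E]

/-- Near a regular point, the orbits are the fibres of a submersion. -/
theorem IsRegularPoint.exists_submersion {x : M} (hx : IsRegularPoint G x) {d : ℕ}
    (hd : Module.finrank ℝ E - orbitRank A E G x = d) :
    ∃ (W : Set M) (b : M → EuclideanSpace ℝ (Fin d)), IsOpen W ∧ x ∈ W ∧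
      ∀ y ∈ W, ContMDiffAt 𝓘(ℝ, E) (𝓡 d) ∞ b y ∧
        Function.Surjective (mfderiv 𝓘(ℝ, E) (𝓡 d) b y) ∧
        SameOrbitType G x y ∧
        ∀ y' ∈ W, b y = b y' ↔ ∃ g : G, g • y = y' := by
  have : IsTopologicalGroup G := topologicalGroup_of_lieGroup 𝓘(ℝ, A) ∞
  subst hd
  obtain ⟨c⟩ := exists_nonempty_orbitCoordinates (A := A) (E := E) (G := G) x
  obtain ⟨U, hU, hinv⟩ := c.exists_eventually_coord_smul
  have hreg : ∀ᶠ y in 𝓝 x, SameOrbitType G x y := hx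
  set b : M → EuclideanSpace ℝ (Fin (Module.finrank ℝ E - orbitRank A E G x)) :=
    fun y => (c.coord y).2 with hb
  -- Regularity enters here: the orbits near `x` have the dimension of the orbit of `x`, which is
  -- what local invariance requires.
  have hinv' : ∀ᶠ y in 𝓝 x, ∀ g ∈ U, b (g • y) = b y := by
    filter_upwards [hinv, hreg] with y h1 h2
    exact h1 h2.orbitRank_eq.le
  have hmv : Tendsto (fun z : G × M => z.1⁻¹ • z.2) (𝓝 1 ×ˢ 𝓝 x) (𝓝 x) := by
    have : Continuous fun z : G × M => z.1⁻¹ • z.2 := by fun_prop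
    have := this.tendsto (1, x)
    simpa [nhds_prod_eq] using this
  obtain ⟨pa, hpa, pb, hpb, hprod⟩ := eventually_prod_iff.1 (hmv.eventually hinv')
  -- These are the requirements on the `k` for which `k⁻¹ • y` is fixed by the stabilizer of `x`:
  -- `k` and its conjugates `h * k * h⁻¹` lie in `U`, and `pa k` keeps `k⁻¹ • y` where `b` is
  -- invariant under `U`.
  have hU' : {k : G | (k ∈ U ∧ pa k) ∧ ∀ h ∈ stabilizer G x, h * k * h⁻¹ ∈ U} ∈ 𝓝 (1 : G) :=
    (Filter.Eventually.and hU hpa).and (eventually_conj_stabilizer_mem x hU)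
  have hD := eventually_exists_eq_mul_stabilizer x hU
  rw [nhds_prod_eq] at hD
  obtain ⟨WD, hWD, hWD'⟩ := (eventually_prod_self_iff (r := fun y y' => ∀ g : G, g • y = y' →
    ∃ u ∈ U, ∃ h ∈ stabilizer G x, g = u * h)).1 hD
  have hgood : ∀ᶠ y in 𝓝 x, SameOrbitType G x y ∧
      (∀ h ∈ stabilizer G x, ∀ g ∈ U, b (g • h • y) = b (h • y)) ∧
      (∃ k : G, ((k ∈ U ∧ pa k) ∧ ∀ h ∈ stabilizer G x, h * k * h⁻¹ ∈ U) ∧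
        ∀ h ∈ stabilizer G x, h • k⁻¹ • y = k⁻¹ • y) ∧ pb y ∧ y ∈ WD := by
    filter_upwards [hreg, eventually_forall_stabilizer_smul (G := G) hinv',
      eventually_exists_stabilizer_eq_conj x hU', hpb, hWD] with y h1 h2 h3 h4 h5
    exact ⟨h1, h2, h3 h1, h4, h5⟩
  have hall := (hgood.and (c.smooth_coord.and (c.surjective_mfderiv_coord.and c.smul_coord)))
  obtain ⟨W, hW, hWo, hxW⟩ := eventually_nhds_iff.1 hall
  refine ⟨W, b, hWo, hxW, fun y hy => ?_⟩
  obtain ⟨⟨ht, hsm, ⟨k, ⟨⟨hkU, hkpa⟩, hkc⟩, hkf⟩, hpby, hyD⟩, hcs, hcd, hcy⟩ := hW y hy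
  have hsnd : ∀ z, ContMDiffAt 𝓘(ℝ, EuclideanSpace ℝ (Fin (orbitRank A E G x)) ×
      EuclideanSpace ℝ (Fin (Module.finrank ℝ E - orbitRank A E G x))) (𝓡 _) ∞
      Prod.snd z := fun z => contDiff_snd.contMDiff.contMDiffAt
  refine ⟨(hsnd _).comp y hcs, ?_, ht, fun y' hy' => ⟨fun h => ?_, ?_⟩⟩
  · have h1 : HasMFDerivAt 𝓘(ℝ, E) (𝓡 _) b y _ :=
      HasMFDerivAt.comp y (hasFDerivAt_snd (p := c.coord y)).hasMFDerivAt
        (hcs.mdifferentiableAt (by simp)).hasMFDerivAt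
    rw [h1.mfderiv]
    intro v
    obtain ⟨w, hw⟩ := hcd ((0 : EuclideanSpace ℝ (Fin (orbitRank A E G x))), v)
    exact ⟨w, congrArg Prod.snd hw⟩
  · obtain ⟨-, -, -, hcy'⟩ := hW y' hy'
    have h' : (c.coord y).2 = (c.coord y').2 := h
    rw [h'] at hcy
    refine ⟨c.e (c.j (c.coord y').1) * (c.e (c.j (c.coord y).1))⁻¹, ?_⟩
    have h1 : (c.e (c.j (c.coord y).1))⁻¹ • y = c.σ (c.coord y').2 := inv_smul_eq_iff.2 hcy.symm
    rw [mul_smul, h1, hcy']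
  · rintro ⟨g, rfl⟩
    obtain ⟨⟨-, -, -, -, hyD'⟩, -⟩ := hW _ hy'
    -- The factor `u` does not change `b`. For `h`, put `w = k⁻¹ • y`, which `h` fixes: then `h • y
    -- = (h * k * h⁻¹) • w` and `y = k • w`, with both group elements in `U`, so `b (h • y) = b w =
    -- b y`.
    obtain ⟨u, hu, h, hh, rfl⟩ := hWD' y hyD _ hyD' g rfl
    have hz := hprod hkpa hpby
    have h1 : b ((u * h) • y) = b (h • y) := by rw [mul_smul]; exact hsm h hh u hu
    have h2 : h • y = (h * k * h⁻¹) • k⁻¹ • y := by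
      conv_rhs => rw [← hkf h hh]
      simp [smul_smul, mul_assoc]
    have h3 : b (h • y) = b (k⁻¹ • y) := by rw [h2]; exact hz _ (hkc h hh)
    have h4 : b y = b (k⁻¹ • y) := by
      have := hz k hkU
      rwa [smul_inv_smul] at this
    rw [h1, h3, h4]

end LocalQuotient

/-! ### Manifold structure on a quotient by local submersions -/

section QuotientManifold

variable {E F : Type*} [NormedAddCommGroup E] [NormedSpace ℝ E]
  [NormedAddCommGroup F] [NormedSpace ℝ F] [FiniteDimensional ℝ F]
  {M N : Type*} [TopologicalSpace M] [ChartedSpace E M] [IsManifold 𝓘(ℝ, E) ∞ M]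
  [TopologicalSpace N]

/-- A submersion `b` on `W` whose fibres are those of `p`. -/
structure FibreSubmersion (E F : Type*) [NormedAddCommGroup E] [NormedSpace ℝ E]
    [NormedAddCommGroup F] [NormedSpace ℝ F] {M N : Type*} [TopologicalSpace M]
    [ChartedSpace E M] (p : M → N) where
  W : Set M
  b : M → F
  isOpen : IsOpen W
  smooth : ∀ y ∈ W, ContMDiffAt 𝓘(ℝ, E) 𝓘(ℝ, F) ∞ b y
  surjective : ∀ y ∈ W, Function.Surjective (mfderiv 𝓘(ℝ, E) 𝓘(ℝ, F) b y)
  fibre : ∀ y ∈ W, ∀ y' ∈ W, b y = b y' ↔ p y = p y'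

namespace FibreSubmersion

variable {p : M → N} (c : FibreSubmersion E F p)

lemma eventually_smooth {w : M} (hw : w ∈ c.W) :
    ∀ᶠ y in 𝓝 w, ContMDiffAt 𝓘(ℝ, E) 𝓘(ℝ, F) ∞ c.b y := by
  filter_upwards [c.isOpen.mem_nhds hw] with y hy using c.smooth y hy

lemma image_mem_nhds {w : M} (hw : w ∈ c.W) {V : Set M} (hV : V ∈ 𝓝 w) :
    c.b '' V ∈ 𝓝 (c.b w) :=
  image_mem_nhds_of_surjective_mfderiv (c.eventually_smooth hw) (c.surjective w hw) hV

/-- The map induced by `b` on the quotient. -/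
def toFun [Nonempty M] (y : N) : F := c.b (Function.invFunOn p c.W y)

/-- The inverse of the map induced by `b` on the quotient. -/
def invFun [Nonempty M] (u : F) : N := p (Function.invFunOn c.b c.W u)

lemma toFun_apply [Nonempty M] {w : M} (hw : w ∈ c.W) : c.toFun (p w) = c.b w := by
  have h : ∃ a ∈ c.W, p a = p w := ⟨w, hw, rfl⟩
  exact (c.fibre _ (Function.invFunOn_mem h) w hw).2 (Function.invFunOn_eq h)

lemma invFun_apply [Nonempty M] {w : M} (hw : w ∈ c.W) : c.invFun (c.b w) = p w := by
  have h : ∃ a ∈ c.W, c.b a = c.b w := ⟨w, hw, rfl⟩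
  exact (c.fibre _ (Function.invFunOn_mem h) w hw).1 (Function.invFunOn_eq h)

/-- The chart of the quotient defined by a submersion with the right fibres. -/
def chart [Nonempty M] (hp : Continuous p) (hpo : IsOpenMap p) : OpenPartialHomeomorph N F where
  toFun := c.toFun
  invFun := c.invFun
  source := p '' c.W
  target := c.b '' c.W
  map_source' := by
    rintro _ ⟨w, hw, rfl⟩
    rw [c.toFun_apply hw]; exact ⟨w, hw, rfl⟩
  map_target' := by
    rintro _ ⟨w, hw, rfl⟩
    rw [c.invFun_apply hw]; exact ⟨w, hw, rfl⟩
  left_inv' := by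
    rintro _ ⟨w, hw, rfl⟩
    rw [c.toFun_apply hw, c.invFun_apply hw]
  right_inv' := by
    rintro _ ⟨w, hw, rfl⟩
    rw [c.invFun_apply hw, c.toFun_apply hw]
  open_source := hpo _ c.isOpen
  open_target := by
    rw [isOpen_iff_mem_nhds]
    rintro _ ⟨w, hw, rfl⟩
    exact c.image_mem_nhds hw (c.isOpen.mem_nhds hw)
  continuousOn_toFun := by
    rintro _ ⟨w, hw, rfl⟩
    refine ContinuousAt.continuousWithinAt ?_
    rw [ContinuousAt, c.toFun_apply hw]
    refine Tendsto.mono_left ?_ (hpo.nhds_le w)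
    refine tendsto_map'_iff.2 (((c.smooth w hw).continuousAt.tendsto).congr' ?_)
    filter_upwards [c.isOpen.mem_nhds hw] with z hz using (c.toFun_apply hz).symm
  continuousOn_invFun := by
    rintro _ ⟨w, hw, rfl⟩
    refine ContinuousAt.continuousWithinAt ?_
    rw [ContinuousAt, c.invFun_apply hw]
    refine Tendsto.mono_left (α := F) (x := map c.b (𝓝 w)) ?_ ?_
    · refine tendsto_map'_iff.2 ((hp.tendsto w).congr' ?_)
      filter_upwards [c.isOpen.mem_nhds hw] with z hz using (c.invFun_apply hz).symm
    · intro V hV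
      filter_upwards [c.image_mem_nhds hw hV] with u hu
      obtain ⟨z, hz, rfl⟩ := hu
      exact hz

end FibreSubmersion

/-- A quotient map whose fibres are locally the fibres of submersions, and whose fibres are
homogeneous, defines a manifold structure on the quotient. -/
theorem exists_quotientManifold {p : M → N} (hp : Continuous p) (hpo : IsOpenMap p)
    (hps : Function.Surjective p)
    (hloc : ∀ x, ∃ c : FibreSubmersion E F p, x ∈ c.W)
    (htr : ∀ x w, p x = p w → ∃ φ : M → M, ContMDiff 𝓘(ℝ, E) 𝓘(ℝ, E) ∞ φ ∧ φ x = w ∧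
      (∀ z, p (φ z) = p z) ∧ Function.Surjective (mfderiv 𝓘(ℝ, E) 𝓘(ℝ, E) φ x)) :
    ∃ _ : ChartedSpace F N, IsManifold 𝓘(ℝ, F) ∞ N ∧
      ContMDiff 𝓘(ℝ, E) 𝓘(ℝ, F) ∞ p ∧
      ∀ x, Function.Surjective (mfderiv 𝓘(ℝ, E) 𝓘(ℝ, F) p x) := by
  -- The charts are built from `Function.invFunOn`, which needs a point of `M`.
  rcases isEmpty_or_nonempty M with hM | hM
  · have : IsEmpty N := ⟨fun y => hM.elim (hps y).choose⟩
    refine ⟨⟨∅, fun y => this.elim y, fun y => this.elim y, fun y => this.elim y⟩, ?_, ?_, ?_⟩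
    · let : ChartedSpace F N :=
        ⟨∅, fun y => this.elim y, fun y => this.elim y, fun y => this.elim y⟩
      exact isManifold_of_contDiffOn _ _ _ fun e e' he => he.elim
    · exact fun x => hM.elim x
    · exact fun x => hM.elim x
  -- A chart is tied to `b` only on `W`. At any other point `z` of a fibre meeting `W`, a
  -- fibre-preserving map `φ` carries `z` into `W`, and the chart composed with `p` is `b ∘ φ` near
  -- `z`.
  have hrep : ∀ (c : FibreSubmersion E F p) (z : M), p z ∈ p '' c.W →
      ContMDiffAt 𝓘(ℝ, E) 𝓘(ℝ, F) ∞ (fun y => c.toFun (p y)) z ∧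
        Function.Surjective (mfderiv 𝓘(ℝ, E) 𝓘(ℝ, F) (fun y => c.toFun (p y)) z) := by
    rintro c z ⟨w, hw, hwz⟩
    obtain ⟨φ, hφ, hφz, hφp, hφs⟩ := htr z w hwz.symm
    have h1 : (fun y => c.toFun (p y)) =ᶠ[𝓝 z] fun y => c.b (φ y) := by
      have : Tendsto φ (𝓝 z) (𝓝 w) := by
        have := hφ.continuous.tendsto z
        rwa [hφz] at this
      filter_upwards [this (c.isOpen.mem_nhds hw)] with y hy
      rw [← hφp y]; exact c.toFun_apply hy
    have h2 : ContMDiffAt 𝓘(ℝ, E) 𝓘(ℝ, F) ∞ c.b (φ z) := by rw [hφz]; exact c.smooth w hw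
    refine ⟨(h2.comp z (hφ z)).congr_of_eventuallyEq h1, ?_⟩
    rw [h1.mfderiv_eq]
    have h3 := mfderiv_comp z (h2.mdifferentiableAt (by simp)) (hφ.mdifferentiable (by simp) z)
    have h4 : mfderiv 𝓘(ℝ, E) 𝓘(ℝ, F) (fun y => c.b (φ y)) z = _ := h3
    rw [h4]
    have h5 : Function.Surjective (mfderiv 𝓘(ℝ, E) 𝓘(ℝ, F) c.b (φ z)) := by
      rw [hφz]; exact c.surjective w hw
    exact Function.Surjective.comp (g := mfderiv 𝓘(ℝ, E) 𝓘(ℝ, F) c.b (φ z)) h5 hφs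
  choose c hc using hloc
  let cs : ChartedSpace F N :=
    { atlas := range fun x => (c x).chart hp hpo
      chartAt := fun y => (c (hps y).choose).chart hp hpo
      mem_chart_source := fun y => ⟨_, hc _, (hps y).choose_spec⟩
      chart_mem_atlas := fun y => ⟨_, rfl⟩ }
  have hman : IsManifold 𝓘(ℝ, F) ∞ N := by
    refine isManifold_of_contDiffOn _ _ _ ?_
    rintro _ _ ⟨x₁, rfl⟩ ⟨x₂, rfl⟩
    rintro u ⟨hu, -⟩
    refine ContDiffAt.contDiffWithinAt ?_
    obtain ⟨⟨w, hw, rfl⟩, hu2⟩ := hu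
    have hu3 : (c x₁).invFun ((c x₁).b w) ∈ p '' (c x₂).W := hu2
    rw [(c x₁).invFun_apply hw] at hu3
    -- A local section `s` of the first submersion writes the change of charts as the second chart
    -- composed with `p ∘ s`.
    obtain ⟨s, hs0, hs⟩ := exists_localSection ((c x₁).eventually_smooth hw)
      ((c x₁).surjective w hw)
    have h1 := (hrep (c x₂) w hu3).1
    rw [← contMDiffAt_iff_contDiffAt]
    have h2 : ContMDiffAt 𝓘(ℝ, E) 𝓘(ℝ, F) ∞ (fun y => (c x₂).toFun (p y)) (s ((c x₁).b w)) := by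
      rw [hs0]; exact h1
    refine (h2.comp _ hs.self_of_nhds.1).congr_of_eventuallyEq ?_
    have hst := hs.self_of_nhds.1.continuousAt.tendsto
    rw [hs0] at hst
    filter_upwards [hs, hst ((c x₁).isOpen.mem_nhds hw)] with u hu hu'
    have h3 : (c x₁).invFun u = p (s u) := by
      rw [← (c x₁).invFun_apply hu', hu.2]
    change (c x₂).toFun ((c x₁).invFun u) = (c x₂).toFun (p (s u))
    rw [h3]
  have hsm : ContMDiff 𝓘(ℝ, E) 𝓘(ℝ, F) ∞ p := by
    intro x
    rw [contMDiffAt_iff_target]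
    exact ⟨hp.continuousAt, (hrep (c (hps (p x)).choose) x
      ⟨_, hc _, (hps (p x)).choose_spec⟩).1⟩
  refine ⟨cs, hman, hsm, fun x => ?_⟩
  have h1 := (hrep (c (hps (p x)).choose) x ⟨_, hc _, (hps (p x)).choose_spec⟩).2
  have h2 : MDifferentiableAt 𝓘(ℝ, F) 𝓘(ℝ, F) (extChartAt 𝓘(ℝ, F) (p x)) (p x) :=
    (contMDiffAt_extChartAt (n := ∞)).mdifferentiableAt (by simp)
  have h3 := mfderiv_comp x h2 (hsm.mdifferentiable (by simp) x)
  have h4 : mfderiv 𝓘(ℝ, E) 𝓘(ℝ, F) (fun y => (c (hps (p x)).choose).toFun (p y)) x = _ := h3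
  rw [h4] at h1
  have h5 : (mfderiv 𝓘(ℝ, F) 𝓘(ℝ, F) (extChartAt 𝓘(ℝ, F) (p x)) (p x)).IsInvertible :=
    isInvertible_mfderiv_extChartAt (mem_extChartAt_source _)
  intro v
  obtain ⟨w, hw⟩ := h1 (mfderiv 𝓘(ℝ, F) 𝓘(ℝ, F) (extChartAt 𝓘(ℝ, F) (p x)) (p x) v)
  exact ⟨w, h5.injective hw⟩

end QuotientManifold

/-! ### Refinements of bounded order and finite families of local objects -/

section CoveringDimension

/-- The open cubes of side `2` centred at integer points have multiplicity at most `2 ^ d`. -/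
lemma encard_setOf_abs_sub_lt_one_le {d : ℕ} (t : Fin d → ℝ) :
    {k : Fin d → ℤ | ∀ i, |t i - k i| < 1}.encard ≤ (2 ^ d : ℕ) := by
  have h1 : {k : Fin d → ℤ | ∀ i, |t i - k i| < 1} ⊆
      (Fintype.piFinset fun i => ({⌊t i⌋, ⌊t i⌋ + 1} : Finset ℤ) : Finset (Fin d → ℤ)) := by
    intro k hk
    simp only [Finset.mem_coe, Fintype.mem_piFinset, Finset.mem_insert, Finset.mem_singleton]
    intro i
    obtain ⟨h1, h2⟩ := abs_lt.1 (hk i)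
    have h3 : k i < ⌊t i⌋ + 2 := by
      have := Int.lt_floor_add_one (t i)
      have h : (k i : ℝ) < ((⌊t i⌋ + 2 : ℤ) : ℝ) := by push_cast; linarith
      exact_mod_cast h
    have h4 : ⌊t i⌋ < k i + 1 := by
      have := Int.floor_le (t i)
      have h : ((⌊t i⌋ : ℤ) : ℝ) < ((k i + 1 : ℤ) : ℝ) := by push_cast; linarith
      exact_mod_cast h
    omega
  refine (encard_le_encard h1).trans ?_
  rw [encard_coe_eq_coe_finsetCard]
  have h2 : (Fintype.piFinset fun i => ({⌊t i⌋, ⌊t i⌋ + 1} : Finset ℤ)).card ≤ 2 ^ d := by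
    rw [Fintype.card_piFinset]
    refine (Finset.prod_le_prod' fun i _ => Finset.card_le_two).trans ?_
    simp
  exact_mod_cast h2

variable {N : Type*} [TopologicalSpace N]

/-- An open cover of a compact subset of a chart has a refinement of order at most `2 ^ d`. -/
lemma exists_refinement_of_isCompact {d : ℕ} (f : OpenPartialHomeomorph N (Fin d → ℝ))
    {C : Set N} (hC : IsCompact C) (hCf : C ⊆ f.source) {ι : Type*} {U : ι → Set N}
    (hU : ∀ i, IsOpen (U i)) (hCU : C ⊆ ⋃ i, U i) :
    ∃ V : ι → Set N, (∀ i, IsOpen (V i)) ∧ C ⊆ ⋃ i, V i ∧ (∀ i, V i ∩ C ⊆ U i) ∧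
      ∀ x, {i | x ∈ V i}.encard ≤ (2 ^ d : ℕ) := by
  have hfC : IsCompact (f '' C) := hC.image_of_continuousOn (f.continuousOn.mono hCf)
  have hcov : f '' C ⊆ ⋃ i, f '' (f.source ∩ U i) := by
    rintro _ ⟨x, hx, rfl⟩
    obtain ⟨i, hi⟩ := mem_iUnion.1 (hCU hx)
    exact mem_iUnion.2 ⟨i, x, ⟨hCf hx, hi⟩, rfl⟩
  obtain ⟨δ, hδ, hleb⟩ := lebesgue_number_lemma_of_metric hfC
    (fun i => f.isOpen_image_source_inter (hU i)) hcov
  -- The cubes below have side `2 * ε = δ`, so two points of one cube are at sup-distance less than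
  -- the Lebesgue number `δ`, and the trace of the cube on `C` lies in a single `U i`.
  set ε := δ / 2 with hε
  have hε0 : 0 < ε := by positivity
  set Q : (Fin d → ℤ) → Set N := fun k => {x | x ∈ f.source ∧ ∀ i, |f x i / ε - k i| < 1} with hQ
  have hQo : ∀ k, IsOpen (Q k) := by
    intro k
    have h1 : IsOpen {v : Fin d → ℝ | ∀ i, |v i / ε - k i| < 1} := by
      simp only [ofPred_forall]
      exact isOpen_iInter_of_finite fun i => isOpen_lt (by fun_prop) continuous_const
    exact f.isOpen_inter_preimage h1
  have hchoose : ∀ k : {k : Fin d → ℤ // (Q k ∩ C).Nonempty}, ∃ i, Q k ∩ C ⊆ U i := by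
    rintro ⟨k, x, hxQ, hxC⟩
    obtain ⟨i, hi⟩ := hleb (f x) ⟨x, hxC, rfl⟩
    refine ⟨i, fun y hy => ?_⟩
    have h1 : f y ∈ Metric.ball (f x) δ := by
      rw [Metric.mem_ball, dist_pi_lt_iff hδ]
      intro l
      have h2 := abs_lt.1 (hxQ.2 l)
      have h3 := abs_lt.1 (hy.1.2 l)
      have h4 : |f y l / ε - f x l / ε| < 2 := by rw [abs_lt]; constructor <;> linarith
      rw [← sub_div, abs_div, abs_of_pos hε0, div_lt_iff₀ hε0] at h4
      rw [Real.dist_eq]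
      linarith
    obtain ⟨z, ⟨hz, hzU⟩, hzy⟩ := hi h1
    rwa [← f.injOn hz hy.1.1 hzy]
  choose a ha using hchoose
  -- Merging the cubes assigned to the same index cannot raise the multiplicity.
  refine ⟨fun i => ⋃ k : {k : Fin d → ℤ // (Q k ∩ C).Nonempty}, ⋃ _ : a k = i, Q k,
    fun i => isOpen_iUnion fun k => isOpen_iUnion fun _ => hQo k, ?_, ?_, ?_⟩
  · intro x hx
    have hxQ : x ∈ Q fun i => ⌊f x i / ε⌋ := by
      refine ⟨hCf hx, fun i => ?_⟩
      rw [abs_lt]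
      constructor <;> linarith [Int.floor_le (f x i / ε), Int.lt_floor_add_one (f x i / ε)]
    exact mem_iUnion.2 ⟨a ⟨_, x, hxQ, hx⟩, mem_iUnion.2 ⟨_, mem_iUnion.2 ⟨rfl, hxQ⟩⟩⟩
  · rintro i x ⟨hx, hxC⟩
    obtain ⟨k, hk⟩ := mem_iUnion.1 hx
    obtain ⟨h, hkQ⟩ := mem_iUnion.1 hk
    subst h
    exact ha k ⟨hkQ, hxC⟩
  · intro x
    have h1 : {i | x ∈ ⋃ k : {k : Fin d → ℤ // (Q k ∩ C).Nonempty}, ⋃ _ : a k = i, Q k} ⊆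
        a '' {k | x ∈ Q k} := by
      intro i hx
      obtain ⟨k, hk⟩ := mem_iUnion.1 hx
      obtain ⟨h, hkQ⟩ := mem_iUnion.1 hk
      subst h
      exact ⟨k, hkQ, rfl⟩
    refine (encard_le_encard h1).trans ((encard_image_le _ _).trans ?_)
    rw [← Subtype.val_injective.encard_image]
    refine (encard_le_encard ?_).trans (encard_setOf_abs_sub_lt_one_le fun i => f x i / ε)
    rintro _ ⟨k, hk, rfl⟩
    exact hk.2

variable [T2Space N]

/-- Shrinking an open cover so that it has bounded order on each of the sets of a locally finite
sequence. -/
lemma exists_refinement_of_locallyFinite {m : ℕ} {C : ℕ → Set N} (hC : ∀ j, IsClosed (C j))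
    (hCl : LocallyFinite C) (hCcov : ⋃ j, C j = univ) {ι : Type*}
    (href : ∀ j, ∀ U : ι → Set N, (∀ i, IsOpen (U i)) → C j ⊆ ⋃ i, U i →
      ∃ V : ι → Set N, (∀ i, IsOpen (V i)) ∧ C j ⊆ ⋃ i, V i ∧ (∀ i, V i ∩ C j ⊆ U i) ∧
      ∀ x, {i | x ∈ V i}.encard ≤ m)
    {U : ι → Set N} (hU : ∀ i, IsOpen (U i)) (hcov : ⋃ i, U i = univ) :
    ∃ V : ι → Set N, (∀ i, IsOpen (V i)) ∧ ⋃ i, V i = univ ∧ (∀ i, V i ⊆ U i) ∧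
      ∀ x, {i | x ∈ V i}.encard ≤ m := by
  have step : ∀ j (U : {U : ι → Set N // (∀ i, IsOpen (U i)) ∧ ⋃ i, U i = univ}),
      ∃ U' : {U : ι → Set N // (∀ i, IsOpen (U i)) ∧ ⋃ i, U i = univ},
        (∀ i, U'.1 i ⊆ U.1 i) ∧ (∀ i, U.1 i \ C j ⊆ U'.1 i) ∧
        ∀ x ∈ C j, {i | x ∈ U'.1 i}.encard ≤ m := by
    rintro j ⟨U, hU, hcov⟩
    obtain ⟨V, hV, hCV, hVU, hVm⟩ := href j U hU (by rw [hcov]; exact subset_univ _)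
    -- Nothing changes off `C j`, while on `C j` the new set is contained in `V i`, whose order is
    -- bounded.
    refine ⟨⟨fun i => U i \ (C j \ V i), fun i => (hU i).sdiff ((hC j).sdiff (hV i)), ?_⟩,
      fun i => sdiff_subset, fun i => sdiff_subset_sdiff_right sdiff_subset, fun x hx => ?_⟩
    · refine eq_univ_of_forall fun x => ?_
      by_cases hx : x ∈ C j
      · obtain ⟨i, hi⟩ := mem_iUnion.1 (hCV hx)
        exact mem_iUnion.2 ⟨i, hVU i ⟨hi, hx⟩, fun h => h.2 hi⟩
      · obtain ⟨i, hi⟩ := mem_iUnion.1 (hcov.ge (mem_univ x))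
        exact mem_iUnion.2 ⟨i, hi, fun h => hx h.1⟩
    · refine (encard_le_encard fun i hi => ?_).trans (hVm x)
      by_contra h
      exact hi.2 ⟨hx, h⟩
  choose next h1 h2 h3 using step
  let S : ℕ → {U : ι → Set N // (∀ i, IsOpen (U i)) ∧ ⋃ i, U i = univ} :=
    fun j => Nat.rec ⟨U, hU, hcov⟩ next j
  have hSs : ∀ j, S (j + 1) = next j (S j) := fun j => rfl
  have hanti : ∀ i, Antitone fun j => (S j).1 i := fun i =>
    antitone_nat_of_succ_le fun j => by rw [hSs]; exact h1 j _ i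
  -- Only finitely many `C j` meet a small neighbourhood, so the shrinking stops there after
  -- finitely many steps. The infinite intersection is thus still an open cover.
  have hloc : ∀ x, ∃ O ∈ 𝓝 x, ∃ J, ∀ i, ∀ y ∈ O, y ∈ (S J).1 i → ∀ j, y ∈ (S j).1 i := by
    intro x
    obtain ⟨O, hO, hfin⟩ := hCl x
    obtain ⟨J, hJ⟩ := hfin.bddAbove
    refine ⟨O, hO, J + 1, fun i y hy hyS j => ?_⟩
    induction j with
    | zero => exact hanti i (Nat.zero_le (J + 1)) hyS
    | succ j ih =>
      rcases le_or_gt (j + 1) (J + 1) with h | h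
      · exact hanti i h hyS
      · rw [hSs]
        refine h2 j _ i ⟨ih, fun hyC => ?_⟩
        have := hJ (show j ∈ {j | (C j ∩ O).Nonempty} from ⟨y, hyC, hy⟩)
        omega
  refine ⟨fun i => ⋂ j, (S j).1 i, fun i => ?_, ?_, fun i => iInter_subset _ 0, fun x => ?_⟩
  · rw [isOpen_iff_mem_nhds]
    intro x hx
    obtain ⟨O, hO, J, h⟩ := hloc x
    filter_upwards [hO, ((S J).2.1 i).mem_nhds (mem_iInter.1 hx J)] with y hy hy'
    exact mem_iInter.2 (h i y hy hy')
  · refine eq_univ_of_forall fun x => ?_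
    obtain ⟨O, hO, J, h⟩ := hloc x
    obtain ⟨i, hi⟩ := mem_iUnion.1 ((S J).2.2.ge (mem_univ x))
    exact mem_iUnion.2 ⟨i, mem_iInter.2 (h i x (mem_of_mem_nhds hO) hi)⟩
  · obtain ⟨j, hj⟩ := mem_iUnion.1 (hCcov.ge (mem_univ x))
    refine (encard_le_encard fun i hi => ?_).trans (h3 j (S j) x hj)
    rw [← hSs]
    exact mem_iInter.1 hi (j + 1)

/-- Every open cover of a manifold of dimension `d` has a refinement of order at most `2 ^ d`. -/
theorem exists_refinement_of_chartedSpace {d : ℕ} [SecondCountableTopology N]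
    [ChartedSpace (EuclideanSpace ℝ (Fin d)) N] {ι : Type*} {U : ι → Set N}
    (hU : ∀ i, IsOpen (U i)) (hcov : ⋃ i, U i = univ) :
    ∃ V : ι → Set N, (∀ i, IsOpen (V i)) ∧ ⋃ i, V i = univ ∧ (∀ i, V i ⊆ U i) ∧
      ∀ x, {i | x ∈ V i}.encard ≤ (2 ^ d : ℕ) := by
  have : LocallyCompactSpace N := ChartedSpace.locallyCompactSpace (EuclideanSpace ℝ (Fin d)) N
  have hB : ∀ x : N, (𝓝 x).HasBasis (fun s : Set N => (s ∈ 𝓝 x ∧ IsCompact s) ∧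
      s ⊆ (chartAt (EuclideanSpace ℝ (Fin d)) x).source) id := fun x =>
    (compact_basis_nhds x).restrict_subset (chart_source_mem_nhds _ x)
  obtain ⟨a, c, r, hr, hrc, hrl⟩ := refinement_of_locallyCompact_sigmaCompact_of_nhds_basis hB
  have hcount : Countable {i : a // (r i).Nonempty} := by
    have h1 : LocallyFinite fun i : {i : a // (r i).Nonempty} => r i.1 :=
      hrl.comp_injective Subtype.val_injective
    exact countable_univ_iff.1 (h1.countable_univ fun i => i.2)
  obtain ⟨enc⟩ := nonempty_encodable {i : a // (r i).Nonempty}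
  -- The nonempty compact sets `r i` are reindexed by `ℕ`; indices that are not codes receive the
  -- empty set.
  set C : ℕ → Set N := fun j => ⋃ i : {i : a // (r i).Nonempty}, ⋃ _ : Encodable.encode i = j, r i.1
    with hCdef
  have hCi : ∀ i : {i : a // (r i).Nonempty}, C (Encodable.encode i) = r i.1 := by
    intro i
    refine Subset.antisymm (iUnion₂_subset fun i' h => ?_) (subset_iUnion₂_of_subset i rfl subset_rfl)
    rw [Encodable.encode_injective h]
  have hCe : ∀ j, j ∉ range (Encodable.encode : {i : a // (r i).Nonempty} → ℕ) → C j = ∅ := by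
    intro j hj
    exact eq_empty_of_forall_notMem fun x hx => by
      obtain ⟨i, hi⟩ := mem_iUnion.1 hx
      obtain ⟨h, _⟩ := mem_iUnion.1 hi
      exact hj ⟨i, h⟩
  refine exists_refinement_of_locallyFinite (C := C) ?_ ?_ ?_ ?_ hU hcov
  · intro j
    by_cases hj : j ∈ range (Encodable.encode : {i : a // (r i).Nonempty} → ℕ)
    · obtain ⟨i, rfl⟩ := hj
      rw [hCi]; exact (hr i.1).1.2.isClosed
    · rw [hCe j hj]; exact isClosed_empty
  · intro x
    obtain ⟨O, hO, hfin⟩ := hrl x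
    refine ⟨O, hO, ((hfin.preimage Subtype.val_injective.injOn).image
      (Encodable.encode : {i : a // (r i).Nonempty} → ℕ)).subset ?_⟩
    rintro j ⟨y, hy, hyO⟩
    obtain ⟨i, hi⟩ := mem_iUnion.1 hy
    obtain ⟨h, hi⟩ := mem_iUnion.1 hi
    exact ⟨i, ⟨y, hi, hyO⟩, h⟩
  · refine eq_univ_of_forall fun x => ?_
    obtain ⟨i, hi⟩ := mem_iUnion.1 (hrc.ge (mem_univ x))
    refine mem_iUnion.2 ⟨Encodable.encode (⟨i, x, hi⟩ : {i : a // (r i).Nonempty}), ?_⟩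
    rw [hCi]; exact hi
  · intro j U hU hCU
    by_cases hj : j ∈ range (Encodable.encode : {i : a // (r i).Nonempty} → ℕ)
    · obtain ⟨i, rfl⟩ := hj
      rw [hCi] at hCU ⊢
      refine exists_refinement_of_isCompact ((chartAt (EuclideanSpace ℝ (Fin d)) (c i.1)).transHomeomorph
        (EuclideanSpace.equiv (Fin d) ℝ).toHomeomorph) (hr i.1).1.2 ?_ hU hCU
      exact (hr i.1).2
    · refine ⟨fun _ => ∅, fun _ => isOpen_empty, ?_, fun _ => by simp, fun x => by simp⟩
      rw [hCe j hj]; exact empty_subset _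

/-- Local objects on a manifold can be patched into finitely many objects, each of them defined on
an open set, such that these open sets cover the manifold. -/
theorem exists_finite_cover_of_local (d : ℕ) [SecondCountableTopology N]
    [ChartedSpace (EuclideanSpace ℝ (Fin d)) N] {T : Type*} {Q : (N → T) → N → Prop}
    (hQ : ∀ s s' y, s =ᶠ[𝓝 y] s' → Q s y → Q s' y)
    (hloc : ∀ y, ∃ s, ∀ᶠ y' in 𝓝 y, Q s y') :
    ∃ (K : ℕ) (W : Fin K → Set N) (s : Fin K → N → T), (∀ c, IsOpen (W c)) ∧
      ⋃ c, W c = univ ∧ ∀ c, ∀ y ∈ W c, Q (s c) y := by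
  classical
  have : LocallyCompactSpace N := ChartedSpace.locallyCompactSpace (EuclideanSpace ℝ (Fin d)) N
  choose s hs using hloc
  obtain ⟨V, hV, hVcov, hVU, hVm⟩ := exists_refinement_of_chartedSpace (d := d)
    (U := fun y => interior {y' | Q (s y) y'}) (fun y => isOpen_interior)
    (eq_univ_of_forall fun y => mem_iUnion.2 ⟨y, mem_interior_iff_mem_nhds.2 (hs y)⟩)
  obtain ⟨φ, hφ⟩ := PartitionOfUnity.exists_isSubordinate isClosed_univ V hV hVcov.ge
  -- On `B S` the functions indexed by `S` strictly dominate all others. Distinct `S` of equal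
  -- cardinality give disjoint sets, so for a fixed cardinality the local objects glue without any
  -- compatibility.
  set B : Finset N → Set N := fun S => {y | (∀ i ∈ S, 0 < φ i y) ∧
    ∀ i ∈ S, ∀ l, l ∉ S → φ l y < φ i y} with hB
  have hBo : ∀ S, IsOpen (B S) := by
    intro S
    rw [isOpen_iff_mem_nhds]
    rintro y ⟨h1, h2⟩
    obtain ⟨O, hO, hfin⟩ := φ.locallyFinite y
    have hc : ∀ i, ContinuousAt (fun y => φ i y) y := fun i => (φ i).continuous.continuousAt
    have e1 : ∀ᶠ z in 𝓝 y, ∀ i ∈ S, 0 < φ i z :=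
      (Finset.eventually_all S).2 fun i hi => (hc i).eventually (lt_mem_nhds (h1 i hi))
    have e2 : ∀ᶠ z in 𝓝 y, ∀ i ∈ S, ∀ l ∈ hfin.toFinset, l ∉ S → φ l z < φ i z := by
      refine (Finset.eventually_all S).2 fun i hi => (Finset.eventually_all _).2 fun l _ => ?_
      by_cases hl : l ∈ S
      · exact Eventually.of_forall fun z h => absurd hl h
      · exact ((hc l).eventually_lt (hc i) (h2 i hi l hl)).mono fun z hz _ => hz
    filter_upwards [e1, e2, hO] with z hz1 hz2 hzO
    refine ⟨hz1, fun i hi l hl => ?_⟩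
    by_cases hlf : l ∈ hfin.toFinset
    · exact hz2 i hi l hlf hl
    · have : φ l z = 0 := by
        by_contra hne
        exact hlf (hfin.mem_toFinset.2 ⟨z, hne, hzO⟩)
      rw [this]; exact hz1 i hi
  have hBdisj : ∀ S T : Finset N, S.card = T.card → ∀ y, y ∈ B S → y ∈ B T → S = T := by
    intro S T hcard y hS hT
    by_contra hne
    obtain ⟨i, hiS, hiT⟩ := Finset.not_subset.1 fun h => hne (Finset.eq_of_subset_of_card_le h hcard.ge)
    obtain ⟨l, hlT, hlS⟩ := Finset.not_subset.1 fun h =>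
      hne (Finset.eq_of_subset_of_card_le h hcard.le).symm
    exact lt_asymm (hS.2 i hiS l hlS) (hT.2 l hlT i hiT)
  -- Cardinalities `1, …, 2 ^ d` suffice: at each point between `1` and `2 ^ d` of the functions `φ
  -- i` are nonzero, and the point lies in `B S` for the set `S` of their indices.
  set W : Fin (2 ^ d) → Set N := fun c => ⋃ S : Finset N, ⋃ _ : S.card = c + 1, B S with hW
  have hWmem : ∀ c y, y ∈ W c → ∃ S : Finset N, S.card = c + 1 ∧ y ∈ B S := by
    intro c y hy
    obtain ⟨S, hS⟩ := mem_iUnion.1 hy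
    obtain ⟨h, hS⟩ := mem_iUnion.1 hS
    exact ⟨S, h, hS⟩
  have hpick : ∀ S : Finset N, 0 < S.card → ∃ i, i ∈ S := fun S h => Finset.card_pos.1 h
  -- The default `s y y` is used only outside `W c`.
  refine ⟨2 ^ d, W, fun c y => if h : ∃ S : Finset N, S.card = c + 1 ∧ y ∈ B S then
    s (hpick h.choose (by rw [h.choose_spec.1]; omega)).choose y else s y y, ?_, ?_, ?_⟩
  · exact fun c => isOpen_iUnion fun S => isOpen_iUnion fun _ => hBo S
  · refine eq_univ_of_forall fun y => ?_
    have hfin : {i | φ i y ≠ 0}.Finite := φ.locallyFinite.point_finite y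
    have hsub : {i | φ i y ≠ 0} ⊆ {i | y ∈ V i} := fun i hi => hφ i (subset_tsupport _ hi)
    have hcard : hfin.toFinset.card ≤ 2 ^ d := by
      have h1 := (encard_le_encard hsub).trans (hVm y)
      rw [hfin.encard_eq_coe_toFinset_card] at h1
      exact_mod_cast h1
    have hpos : 0 < hfin.toFinset.card := by
      rw [Finset.card_pos]
      obtain ⟨i, hi⟩ := φ.exists_pos (mem_univ y)
      exact ⟨i, hfin.mem_toFinset.2 hi.ne'⟩
    refine mem_iUnion.2 ⟨⟨hfin.toFinset.card - 1, by omega⟩, mem_iUnion.2 ⟨hfin.toFinset,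
      mem_iUnion.2 ⟨by simp only; omega, fun i hi => ?_, fun i hi l hl => ?_⟩⟩⟩
    · exact lt_of_le_of_ne (φ.nonneg i y) (Ne.symm (hfin.mem_toFinset.1 hi))
    · have : φ l y = 0 := by
        by_contra hne
        exact hl (hfin.mem_toFinset.2 hne)
      rw [this]
      exact lt_of_le_of_ne (φ.nonneg i y) (Ne.symm (hfin.mem_toFinset.1 hi))
  · intro c y hy
    obtain ⟨S, hSc, hyS⟩ := hWmem c y hy
    have hSpos : 0 < S.card := by omega
    refine hQ (s (hpick S hSpos).choose) _ y ?_ ?_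
    · filter_upwards [(hBo S).mem_nhds hyS] with z hz
      have h : ∃ S : Finset N, S.card = c + 1 ∧ z ∈ B S := ⟨S, hSc, hz⟩
      have h1 : h.choose = S := hBdisj _ _ (by rw [h.choose_spec.1, hSc]) z h.choose_spec.2 hz
      rw [dif_pos h]
      simp only [h1]
    · have h1 := (hpick S hSpos).choose_spec
      have h2 : y ∈ V (hpick S hSpos).choose :=
        hφ _ (subset_tsupport _ (hyS.1 _ h1).ne')
      exact interior_subset (hVU _ h2)

end CoveringDimension

/-! ### Second-order calculus of the generator on vector-valued functions -/

section Generator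

variable {E F F' : Type*} [NormedAddCommGroup E] [NormedSpace ℝ E]
  [NormedAddCommGroup F] [NormedSpace ℝ F] [NormedAddCommGroup F'] [NormedSpace ℝ F']
  {M : Type*} [TopologicalSpace M] [ChartedSpace E M]

/-- The derivative of a vector-valued function along a vector field. -/
def vecLieDeriv (V : (x : M) → TangentSpace 𝓘(ℝ, E) x) (f : M → F) : M → F :=
  fun x => mvfderiv 𝓘(ℝ, E) f x (V x)

lemma HasMFDerivAt.vecLieDeriv_eq {f : M → F} {x : M} {f' : E →L[ℝ] F}
    (h : HasMFDerivAt 𝓘(ℝ, E) 𝓘(ℝ, F) f x f') (V : (x : M) → TangentSpace 𝓘(ℝ, E) x) :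
    vecLieDeriv V f x = f' (V x) :=
  DFunLike.congr_fun h.mfderiv (V x)

lemma Filter.EventuallyEq.vecLieDeriv {f g : M → F} {x : M} (h : f =ᶠ[𝓝 x] g)
    (V : (x : M) → TangentSpace 𝓘(ℝ, E) x) : vecLieDeriv V f =ᶠ[𝓝 x] vecLieDeriv V g := by
  filter_upwards [h.eventuallyEq_nhds] with y hy
  exact DFunLike.congr_fun hy.mfderiv_eq (V y)

lemma vecLieDeriv_comp (V : (x : M) → TangentSpace 𝓘(ℝ, E) x) {f : M → F} {x : M}
    (hf : MDifferentiableAt 𝓘(ℝ, E) 𝓘(ℝ, F) f x) {Φ : F → F'}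
    (hΦ : DifferentiableAt ℝ Φ (f x)) :
    vecLieDeriv V (fun y => Φ (f y)) x = fderiv ℝ Φ (f x) (vecLieDeriv V f x) :=
  (HasMFDerivAt.comp x hΦ.hasFDerivAt.hasMFDerivAt hf.hasMFDerivAt).vecLieDeriv_eq V

lemma vecLieDeriv_prodMk (V : (x : M) → TangentSpace 𝓘(ℝ, E) x) {f : M → F} {g : M → F'} {x : M}
    (hf : MDifferentiableAt 𝓘(ℝ, E) 𝓘(ℝ, F) f x) (hg : MDifferentiableAt 𝓘(ℝ, E) 𝓘(ℝ, F') g x) :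
    vecLieDeriv V (fun y => (f y, g y)) x = (vecLieDeriv V f x, vecLieDeriv V g x) := by
  have h := hf.prodMk_space hg
  refine Prod.ext ?_ ?_
  · have h1 := vecLieDeriv_comp V h (Φ := Prod.fst) differentiableAt_fst
    rw [fderiv_fst] at h1
    exact h1.symm
  · have h1 := vecLieDeriv_comp V h (Φ := Prod.snd) differentiableAt_snd
    rw [fderiv_snd] at h1
    exact h1.symm

variable [IsManifold 𝓘(ℝ, E) ∞ M]

/-- Pushing forward a smooth family of tangent vectors. -/
lemma ContMDiffAt.tangentMap_comp {E₁ P N : Type*} [NormedAddCommGroup E₁] [NormedSpace ℝ E₁]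
    [TopologicalSpace P] [ChartedSpace E₁ P] [TopologicalSpace N] [ChartedSpace F N]
    [IsManifold 𝓘(ℝ, F) ∞ N] {f : M → N} {W : P → TangentBundle 𝓘(ℝ, E) M} {y : P}
    (hf : ∀ᶠ x in 𝓝 (W y).proj, ContMDiffAt 𝓘(ℝ, E) 𝓘(ℝ, F) ∞ f x)
    (hW : ContMDiffAt 𝓘(ℝ, E₁) 𝓘(ℝ, E).tangent ∞ W y) :
    ContMDiffAt 𝓘(ℝ, E₁) 𝓘(ℝ, F).tangent ∞
      (fun y => tangentMap 𝓘(ℝ, E) 𝓘(ℝ, F) f (W y)) y := by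
  obtain ⟨O, hO, hOo, hyO⟩ := eventually_nhds_iff.1 hf
  have h1 : ContMDiffOn 𝓘(ℝ, E) 𝓘(ℝ, F) ∞ f O := fun x hx => (hO x hx).contMDiffWithinAt
  have h2 := h1.contMDiffOn_tangentMapWithin (m := ∞) (by simp) hOo.uniqueMDiffOn
  have hproj : Continuous (Bundle.TotalSpace.proj : TangentBundle 𝓘(ℝ, E) M → M) :=
    FiberBundle.continuous_proj E (TangentSpace 𝓘(ℝ, E))
  have h3 : Bundle.TotalSpace.proj ⁻¹' O ∈ 𝓝 (W y) := hproj.continuousAt (hOo.mem_nhds hyO)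
  refine ((h2.contMDiffAt h3).comp y hW).congr_of_eventuallyEq ?_
  filter_upwards [hW.continuousAt h3] with z hz
  have hz' : (W z).proj ∈ O := hz
  simp only [tangentMap, Function.comp_apply, tangentMapWithin]
  rw [mfderivWithin_of_isOpen hOo hz']

lemma eventually_contMDiffAt_vecLieDeriv {V : (x : M) → TangentSpace 𝓘(ℝ, E) x}
    (hV : ContMDiff 𝓘(ℝ, E) 𝓘(ℝ, E).tangent ∞ (fun x => (⟨x, V x⟩ : TangentBundle 𝓘(ℝ, E) M)))
    {f : M → F} {x : M} (hf : ∀ᶠ y in 𝓝 x, ContMDiffAt 𝓘(ℝ, E) 𝓘(ℝ, F) ∞ f y) :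
    ∀ᶠ y in 𝓝 x, ContMDiffAt 𝓘(ℝ, E) 𝓘(ℝ, F) ∞ (vecLieDeriv V f) y := by
  filter_upwards [hf.eventually_nhds] with y hy
  have h1 := ContMDiffAt.tangentMap_comp (P := M) (y := y)
    (W := fun x => (⟨x, V x⟩ : TangentBundle 𝓘(ℝ, E) M)) hy hV.contMDiffAt
  exact (contMDiff_snd_tangentBundle_modelSpace F 𝓘(ℝ, F)).contMDiffAt.comp y h1

/-- Near `x`, `V (Φ ∘ f)` is the map `(v, w) ↦ fderiv ℝ Φ v w` evaluated at the pair `(f, V f)`; a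
second differentiation gives a linear term and a Hessian term. -/
lemma vecLieDeriv_vecLieDeriv_comp {V : (x : M) → TangentSpace 𝓘(ℝ, E) x}
    (hV : ContMDiff 𝓘(ℝ, E) 𝓘(ℝ, E).tangent ∞ (fun x => (⟨x, V x⟩ : TangentBundle 𝓘(ℝ, E) M)))
    {f : M → F} {x : M} (hf : ∀ᶠ y in 𝓝 x, ContMDiffAt 𝓘(ℝ, E) 𝓘(ℝ, F) ∞ f y)
    {Φ : F → F'} (hΦ : ∀ᶠ u in 𝓝 (f x), ContDiffAt ℝ ∞ Φ u) :
    vecLieDeriv V (vecLieDeriv V (fun y => Φ (f y))) x =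
      fderiv ℝ Φ (f x) (vecLieDeriv V (vecLieDeriv V f) x) +
        fderiv ℝ (fderiv ℝ Φ) (f x) (vecLieDeriv V f x) (vecLieDeriv V f x) := by
  have hfx := hf.self_of_nhds
  have hVf := (eventually_contMDiffAt_vecLieDeriv hV hf).self_of_nhds
  have h1 : vecLieDeriv V (fun y => Φ (f y)) =ᶠ[𝓝 x]
      fun y => (fun q : F × F => fderiv ℝ Φ q.1 q.2) (f y, vecLieDeriv V f y) := by
    filter_upwards [hf, hfx.continuousAt.eventually hΦ] with y h2 h3
    exact vecLieDeriv_comp V (h2.mdifferentiableAt (by simp)) (h3.differentiableAt (by simp))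
  rw [(h1.vecLieDeriv V).self_of_nhds]
  have h4 : DifferentiableAt ℝ (fderiv ℝ Φ) (f x) :=
    (hΦ.self_of_nhds.fderiv_right (m := 1) (by norm_cast)).differentiableAt (by simp)
  have h5 : HasFDerivAt (fun q : F × F => fderiv ℝ Φ q.1 q.2) _ (f x, vecLieDeriv V f x) :=
    HasFDerivAt.clm_apply (c := fun q : F × F => fderiv ℝ Φ q.1) (u := Prod.snd)
      (HasFDerivAt.comp (f x, vecLieDeriv V f x) h4.hasFDerivAt hasFDerivAt_fst) hasFDerivAt_snd
  have h6 : MDifferentiableAt 𝓘(ℝ, E) 𝓘(ℝ, F × F) (fun y => (f y, vecLieDeriv V f y)) x :=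
    (hfx.mdifferentiableAt (by simp)).prodMk_space (hVf.mdifferentiableAt (by simp))
  rw [vecLieDeriv_comp V h6 h5.differentiableAt, h5.fderiv,
    vecLieDeriv_prodMk V (hfx.mdifferentiableAt (by simp)) (hVf.mdifferentiableAt (by simp))]
  simp

namespace SDS

variable {k : ℕ} (X : SDS 𝓘(ℝ, E) M k)

/-- The pure noise part `½ ∑ Xᵢ²` of the generator on vector-valued functions. -/
def noisePart (f : M → F) : M → F :=
  fun x => (1 / 2 : ℝ) • ∑ i, vecLieDeriv (X.noise i) (vecLieDeriv (X.noise i) f) x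

/-- The generator on vector-valued functions. -/
def vecGenerator (f : M → F) : M → F :=
  fun x => vecLieDeriv X.drift f x + X.noisePart f x

lemma generator_eq_vecGenerator (f : M → ℝ) : X.generator f = X.vecGenerator f := rfl

lemma noisePart_congr {f g : M → F} {x : M} (h : f =ᶠ[𝓝 x] g) :
    X.noisePart f =ᶠ[𝓝 x] X.noisePart g := by
  have h1 : ∀ᶠ y in 𝓝 x, ∀ i, vecLieDeriv (X.noise i) (vecLieDeriv (X.noise i) f) y =
      vecLieDeriv (X.noise i) (vecLieDeriv (X.noise i) g) y :=
    eventually_all.2 fun i => (h.vecLieDeriv (X.noise i)).vecLieDeriv (X.noise i)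
  filter_upwards [h1] with y hy
  simp only [noisePart, hy]

lemma vecGenerator_congr {f g : M → F} {x : M} (h : f =ᶠ[𝓝 x] g) :
    X.vecGenerator f =ᶠ[𝓝 x] X.vecGenerator g := by
  filter_upwards [h.vecLieDeriv X.drift, X.noisePart_congr h] with y h1 h2
  simp only [vecGenerator, h1, h2]

lemma eventually_contMDiffAt_noisePart {f : M → F} {x : M}
    (hf : ∀ᶠ y in 𝓝 x, ContMDiffAt 𝓘(ℝ, E) 𝓘(ℝ, F) ∞ f y) :
    ∀ᶠ y in 𝓝 x, ContMDiffAt 𝓘(ℝ, E) 𝓘(ℝ, F) ∞ (X.noisePart f) y := by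
  have h1 : ∀ᶠ y in 𝓝 x, ∀ i, ContMDiffAt 𝓘(ℝ, E) 𝓘(ℝ, F) ∞
      (vecLieDeriv (X.noise i) (vecLieDeriv (X.noise i) f)) y :=
    eventually_all.2 fun i => eventually_contMDiffAt_vecLieDeriv (X.contMDiff_noise i)
      (eventually_contMDiffAt_vecLieDeriv (X.contMDiff_noise i) hf)
  filter_upwards [h1] with y hy
  exact (contMDiffAt_const (I' := 𝓘(ℝ, ℝ))).smul (ContMDiffAt.sum fun i _ => hy i)

lemma eventually_contMDiffAt_vecGenerator {f : M → F} {x : M}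
    (hf : ∀ᶠ y in 𝓝 x, ContMDiffAt 𝓘(ℝ, E) 𝓘(ℝ, F) ∞ f y) :
    ∀ᶠ y in 𝓝 x, ContMDiffAt 𝓘(ℝ, E) 𝓘(ℝ, F) ∞ (X.vecGenerator f) y := by
  filter_upwards [eventually_contMDiffAt_vecLieDeriv X.contMDiff_drift hf,
    X.eventually_contMDiffAt_noisePart hf] with y h1 h2
  exact h1.add h2

lemma noisePart_comp {f : M → F} {x : M} (hf : ∀ᶠ y in 𝓝 x, ContMDiffAt 𝓘(ℝ, E) 𝓘(ℝ, F) ∞ f y)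
    {Φ : F → F'} (hΦ : ∀ᶠ u in 𝓝 (f x), ContDiffAt ℝ ∞ Φ u) :
    X.noisePart (fun y => Φ (f y)) x = fderiv ℝ Φ (f x) (X.noisePart f x) +
      (1 / 2 : ℝ) • ∑ i, fderiv ℝ (fderiv ℝ Φ) (f x) (vecLieDeriv (X.noise i) f x)
        (vecLieDeriv (X.noise i) f x) := by
  simp only [noisePart]
  rw [map_smul, map_sum, ← smul_add, ← Finset.sum_add_distrib]
  simp only [vecLieDeriv_vecLieDeriv_comp (X.contMDiff_noise _) hf hΦ]

/-- The drift contributes no Hessian term, so the Hessian sum isolates the second-order part of the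
generator. -/
lemma vecGenerator_comp {f : M → F} {x : M}
    (hf : ∀ᶠ y in 𝓝 x, ContMDiffAt 𝓘(ℝ, E) 𝓘(ℝ, F) ∞ f y)
    {Φ : F → F'} (hΦ : ∀ᶠ u in 𝓝 (f x), ContDiffAt ℝ ∞ Φ u) :
    X.vecGenerator (fun y => Φ (f y)) x = fderiv ℝ Φ (f x) (X.vecGenerator f x) +
      (1 / 2 : ℝ) • ∑ i, fderiv ℝ (fderiv ℝ Φ) (f x) (vecLieDeriv (X.noise i) f x)
        (vecLieDeriv (X.noise i) f x) := by
  simp only [vecGenerator]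
  rw [X.noisePart_comp hf hΦ, vecLieDeriv_comp _ (hf.self_of_nhds.mdifferentiableAt (by simp))
    (hΦ.self_of_nhds.differentiableAt (by simp)), map_add, add_assoc]

lemma vecGenerator_clm {f : M → F} {x : M}
    (hf : ∀ᶠ y in 𝓝 x, ContMDiffAt 𝓘(ℝ, E) 𝓘(ℝ, F) ∞ f y) (L : F →L[ℝ] F') :
    X.vecGenerator (fun y => L (f y)) x = L (X.vecGenerator f x) := by
  have h1 : fderiv ℝ (L : F → F') = fun _ => L := by
    funext u; exact L.fderiv
  rw [X.vecGenerator_comp hf (Φ := L) (Eventually.of_forall fun u => L.contDiff.contDiffAt)]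
  rw [h1]
  simp

end SDS

/-- A germ of a smooth function extends to a smooth function. -/
lemma exists_contMDiff_eventuallyEq [FiniteDimensional ℝ E] [T2Space M] {f : M → F} {x : M}
    (hf : ∀ᶠ y in 𝓝 x, ContMDiffAt 𝓘(ℝ, E) 𝓘(ℝ, F) ∞ f y) :
    ∃ g : M → F, ContMDiff 𝓘(ℝ, E) 𝓘(ℝ, F) ∞ g ∧ g =ᶠ[𝓝 x] f := by
  obtain ⟨b, -, hb⟩ := (SmoothBumpFunction.nhds_basis_tsupport (I := 𝓘(ℝ, E)) x).mem_iff.1 hf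
  refine ⟨fun y => b y • f y, contMDiff_of_tsupport fun y hy => ?_, ?_⟩
  · exact b.contMDiffAt.smul (hb (tsupport_smul_subset_left _ _ hy))
  · filter_upwards [b.eventuallyEq_one] with y hy
    simp [hy]

end Generator

/-! ### Vector fields on the base from local sections -/

section ProjectedGenerator

variable {E F F' : Type*} [NormedAddCommGroup E] [NormedSpace ℝ E]
  [NormedAddCommGroup F] [NormedSpace ℝ F] [FiniteDimensional ℝ F]
  [NormedAddCommGroup F'] [NormedSpace ℝ F']
  {M N : Type*} [TopologicalSpace M] [ChartedSpace E M] [IsManifold 𝓘(ℝ, E) ∞ M]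
  [TopologicalSpace N] [ChartedSpace F N] [IsManifold 𝓘(ℝ, F) ∞ N] [T2Space N]

/-- A finite open cover has a subordinate family of functions whose squares sum to `1`. -/
lemma exists_sum_sq_eq_one [SigmaCompactSpace N] {K : ℕ} {W : Fin K → Set N}
    (hW : ∀ c, IsOpen (W c)) (hcov : ⋃ c, W c = univ) :
    ∃ χ : Fin K → N → ℝ, (∀ c, ContMDiff 𝓘(ℝ, F) 𝓘(ℝ, ℝ) ∞ (χ c)) ∧
      (∀ c, tsupport (χ c) ⊆ W c) ∧ ∀ y, ∑ c, χ c y ^ 2 = 1 := by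
  obtain ⟨φ, hφ⟩ := SmoothPartitionOfUnity.exists_isSubordinate 𝓘(ℝ, F) isClosed_univ W hW hcov.ge
  have hpos : ∀ y, 0 < ∑ c, φ c y ^ 2 := by
    intro y
    have h1 : ∑ c, φ c y = 1 := by
      rw [← finsum_eq_sum_of_fintype]; exact φ.sum_eq_one (mem_univ y)
    obtain ⟨c, -, hc⟩ := Finset.exists_ne_zero_of_sum_ne_zero (by rw [h1]; exact one_ne_zero)
    exact Finset.sum_pos' (fun c _ => sq_nonneg _) ⟨c, Finset.mem_univ c, by positivity⟩
  have hsq : ContMDiff 𝓘(ℝ, F) 𝓘(ℝ, ℝ) ∞ fun y => (Real.sqrt (∑ c, φ c y ^ 2))⁻¹ := by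
    intro y
    have h1 : ContMDiffAt 𝓘(ℝ, F) 𝓘(ℝ, ℝ) ∞ (fun y => ∑ c, φ c y ^ 2) y :=
      ContMDiffAt.sum fun c _ => (φ c).contMDiff.contMDiffAt.pow 2
    have h2 : ContDiffAt ℝ ∞ (fun t => (Real.sqrt t)⁻¹) (∑ c, φ c y ^ 2) :=
      (Real.contDiffAt_sqrt (hpos y).ne').inv (Real.sqrt_pos.2 (hpos y)).ne'
    exact ContMDiffAt.comp (g := fun t => (Real.sqrt t)⁻¹) y h2.contMDiffAt h1
  -- It is the squares that are normalised, because noise fields enter the generator quadratically.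
  refine ⟨fun c y => φ c y * (Real.sqrt (∑ c, φ c y ^ 2))⁻¹,
    fun c => (φ c).contMDiff.mul hsq, fun c => ?_, fun y => ?_⟩
  · exact (tsupport_mul_subset_left).trans (hφ c)
  · simp only [mul_pow, inv_pow, Real.sq_sqrt (hpos y).le]
    rw [← Finset.sum_mul, mul_inv_cancel₀ (hpos y).ne']

/-- The vector field `χ • dp(V ∘ s)`, where `s` is a local section of `p`. -/
def sectionField (p : M → N) (χ : N → ℝ) (s : N → M) (V : (x : M) → TangentSpace 𝓘(ℝ, E) x) :
    (y : N) → TangentSpace 𝓘(ℝ, F) y :=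
  fun y => (χ y • (mfderiv 𝓘(ℝ, E) 𝓘(ℝ, F) p (s y) (V (s y)) : F) : F)

/-- Needed because a vector pushed forward from `s y` is based at `p (s y)`, which equals `y` only
propositionally. -/
lemma tangentBundle_mk_congr {y y' : N} (h : y = y') (v : F) :
    (⟨y, v⟩ : TangentBundle 𝓘(ℝ, F) N) = ⟨y', v⟩ := by
  subst h; rfl

/-- On `W` the field is `χ` times the tangent map of `p` along `V ∘ s`; off the support of `χ` it
vanishes, whatever `s` does there. -/
lemma contMDiff_sectionField {p : M → N} (hp : ContMDiff 𝓘(ℝ, E) 𝓘(ℝ, F) ∞ p) {χ : N → ℝ}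
    (hχ : ContMDiff 𝓘(ℝ, F) 𝓘(ℝ, ℝ) ∞ χ) {W : Set N} (hW : IsOpen W) (hχW : tsupport χ ⊆ W)
    {s : N → M} (hs : ∀ y ∈ W, ContMDiffAt 𝓘(ℝ, F) 𝓘(ℝ, E) ∞ s y ∧ p (s y) = y)
    {V : (x : M) → TangentSpace 𝓘(ℝ, E) x}
    (hV : ContMDiff 𝓘(ℝ, E) 𝓘(ℝ, E).tangent ∞
      (fun x => (⟨x, V x⟩ : TangentBundle 𝓘(ℝ, E) M))) :
    ContMDiff 𝓘(ℝ, F) 𝓘(ℝ, F).tangent ∞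
      (fun y => (⟨y, sectionField p χ s V y⟩ : TangentBundle 𝓘(ℝ, F) N)) := by
  set V' : (y : N) → TangentSpace 𝓘(ℝ, F) y :=
    fun y => (mfderiv 𝓘(ℝ, E) 𝓘(ℝ, F) p (s y) (V (s y)) : F) with hV'
  have h1 : ContMDiffOn 𝓘(ℝ, F) 𝓘(ℝ, F).tangent ∞
      (fun y => (⟨y, V' y⟩ : TangentBundle 𝓘(ℝ, F) N)) W := by
    intro y hy
    refine ContMDiffAt.contMDiffWithinAt ?_
    have h2 := ContMDiffAt.tangentMap_comp (f := p) (y := y)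
      (W := fun y => (⟨s y, V (s y)⟩ : TangentBundle 𝓘(ℝ, E) M))
      (Eventually.of_forall fun x => hp x) (hV.contMDiffAt.comp y (hs y hy).1)
    refine h2.congr_of_eventuallyEq ?_
    filter_upwards [hW.mem_nhds hy] with z hz
    exact (tangentBundle_mk_congr (hs z hz).2 _).symm
  exact ContMDiffOn.smul_section_of_tsupport hχ.contMDiffOn hW hχW h1

lemma vecLieDeriv_sectionField {p : M → N} (hp : ContMDiff 𝓘(ℝ, E) 𝓘(ℝ, F) ∞ p) {χ : N → ℝ}
    {s : N → M} {y : N} (hs : p (s y) = y) (V : (x : M) → TangentSpace 𝓘(ℝ, E) x) {u : N → F'}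
    (hu : MDifferentiableAt 𝓘(ℝ, F) 𝓘(ℝ, F') u y) :
    vecLieDeriv (sectionField (F := F) p χ s V) u y =
      χ y • vecLieDeriv V (fun x => u (p x)) (s y) := by
  have h1 : HasMFDerivAt 𝓘(ℝ, F) 𝓘(ℝ, F') u (p (s y))
      (mfderiv 𝓘(ℝ, F) 𝓘(ℝ, F') u y : F →L[ℝ] F') := by
    rw [hs]; exact hu.hasMFDerivAt
  have h2 := (h1.comp (s y) (hp.mdifferentiable (by simp) (s y)).hasMFDerivAt).vecLieDeriv_eq V
  have h3 : vecLieDeriv V (fun x => u (p x)) (s y) = _ := h2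
  rw [h3]
  exact map_smul (mfderiv 𝓘(ℝ, F) 𝓘(ℝ, F') u y : F →L[ℝ] F') (χ y) _

lemma vecLieDeriv_sectionField_of_eq_zero {p : M → N} {χ : N → ℝ} {s : N → M} {y : N}
    (hχ : χ y = 0) (V : (x : M) → TangentSpace 𝓘(ℝ, E) x) (u : N → F') :
    vecLieDeriv (sectionField (F := F) p χ s V) u y = 0 := by
  have h1 : sectionField (F := F) p χ s V y = 0 := by
    unfold sectionField; rw [hχ]; exact zero_smul ℝ _
  unfold vecLieDeriv
  rw [h1]; exact map_zero _

/-- If the generator maps functions of `p` to functions constant on the fibres of `p`, the same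
holds for germs of vector-valued functions. -/
lemma SDS.vecGenerator_eq_of_fibre {k : ℕ} {X : SDS 𝓘(ℝ, E) M k} {p : M → N}
    (hp : ContMDiff 𝓘(ℝ, E) 𝓘(ℝ, F) ∞ p)
    (hinv : ∀ f : N → ℝ, ContMDiff 𝓘(ℝ, F) 𝓘(ℝ, ℝ) ∞ f → ∀ x x', p x = p x' →
      X.generator (f ∘ p) x = X.generator (f ∘ p) x')
    {x x' : M} (hx : p x = p x') {f : N → F'}
    (hf : ∀ᶠ y in 𝓝 (p x), ContMDiffAt 𝓘(ℝ, F) 𝓘(ℝ, F') ∞ f y) :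
    X.vecGenerator (fun z => f (p z)) x = X.vecGenerator (fun z => f (p z)) x' := by
  -- The hypothesis concerns global scalar functions: a cutoff makes the germ global, and continuous
  -- linear functionals then reduce vector values to scalars.
  obtain ⟨g, hg, hgf⟩ := exists_contMDiff_eventuallyEq hf
  have h1 : ∀ z, p z = p x → X.vecGenerator (fun z => f (p z)) z =
      X.vecGenerator (fun z => g (p z)) z := by
    intro z hz
    have h2 : (fun z => f (p z)) =ᶠ[𝓝 z] fun z => g (p z) := by
      have := hp.continuous.tendsto z
      rw [hz] at this
      exact (this.eventually hgf).mono fun w hw => hw.symm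
    exact (X.vecGenerator_congr h2).self_of_nhds
  rw [h1 x rfl, h1 x' hx.symm]
  have hgp : ContMDiff 𝓘(ℝ, E) 𝓘(ℝ, F') ∞ fun z => g (p z) := hg.comp hp
  refine (SeparatingDual.eq_iff_forall_dual_eq (R := ℝ)).2 fun L => ?_
  rw [← X.vecGenerator_clm (Eventually.of_forall fun z => hgp z),
    ← X.vecGenerator_clm (Eventually.of_forall fun z => hgp z)]
  exact hinv (fun y => L (g y)) (L.contMDiff.comp hg) x x' hx

lemma mvfderiv_extChartAt_apply_self (y : N) (v : TangentSpace 𝓘(ℝ, F) y) :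
    mvfderiv 𝓘(ℝ, F) (extChartAt 𝓘(ℝ, F) y) y v = v := by
  have h := mfderiv_extChartAt_self (I := 𝓘(ℝ, F)) (x := y)
  exact DFunLike.congr_fun h v

/-- A vector field is smooth if its coordinates are. -/
lemma contMDiff_section_of_coordinates {V : (y : N) → TangentSpace 𝓘(ℝ, F) y}
    (h : ∀ y₀ : N, ContMDiffAt 𝓘(ℝ, F) 𝓘(ℝ, F) ∞
      (vecLieDeriv V (extChartAt 𝓘(ℝ, F) y₀)) y₀) :
    ContMDiff 𝓘(ℝ, F) 𝓘(ℝ, F).tangent ∞ (fun y => (⟨y, V y⟩ : TangentBundle 𝓘(ℝ, F) N)) := by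
  intro y₀
  have : IsManifold 𝓘(ℝ, F) 1 N := IsManifold.of_le (n := ∞) (by norm_cast)
  refine (Bundle.contMDiffAt_section (IB := 𝓘(ℝ, F)) (F := F) y₀).2 ?_
  refine (h y₀).congr_of_eventuallyEq ?_
  filter_upwards [(chartAt F y₀).open_source.mem_nhds (mem_chart_source F y₀)] with y hy
  have h1 := TangentBundle.continuousLinearMapAt_trivializationAt (I := 𝓘(ℝ, F)) (x₀ := y₀) hy
  have h2 := DFunLike.congr_fun h1 (V y)
  have h3 : (trivializationAt F (TangentSpace 𝓘(ℝ, F)) y₀).continuousLinearMapAt ℝ y (V y) =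
      (trivializationAt F (TangentSpace 𝓘(ℝ, F)) y₀ ⟨y, V y⟩).2 := by
    rw [Bundle.Trivialization.continuousLinearMapAt_apply,
      Bundle.Trivialization.linearMapAt_apply, if_pos (by simpa using hy)]
  rw [← h3]
  exact h2

end ProjectedGenerator

/-! ### The projected stochastic dynamical system -/

section ProjectedSDS

variable {E F F' : Type*} [NormedAddCommGroup E] [NormedSpace ℝ E]
  [NormedAddCommGroup F] [NormedSpace ℝ F] [FiniteDimensional ℝ F]
  [NormedAddCommGroup F'] [NormedSpace ℝ F']
  {M N : Type*} [TopologicalSpace M] [ChartedSpace E M] [IsManifold 𝓘(ℝ, E) ∞ M]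
  [TopologicalSpace N] [ChartedSpace F N] [IsManifold 𝓘(ℝ, F) ∞ N] [T2Space N]

/-- The noise fields obtained from finitely many local sections of `p`, without drift. -/
def liftedNoise {k K : ℕ} (X : SDS 𝓘(ℝ, E) M k) {p : M → N}
    (hp : ContMDiff 𝓘(ℝ, E) 𝓘(ℝ, F) ∞ p) {χ : Fin K → N → ℝ}
    (hχ : ∀ c, ContMDiff 𝓘(ℝ, F) 𝓘(ℝ, ℝ) ∞ (χ c)) {W : Fin K → Set N} (hW : ∀ c, IsOpen (W c))
    (hχW : ∀ c, tsupport (χ c) ⊆ W c) {s : Fin K → N → M}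
    (hs : ∀ c, ∀ y ∈ W c, ContMDiffAt 𝓘(ℝ, F) 𝓘(ℝ, E) ∞ (s c) y ∧ p (s c y) = y) :
    SDS 𝓘(ℝ, F) N (K * k) where
  drift := fun _ => 0
  noise := fun j => sectionField p (χ (finProdFinEquiv.symm j).1) (s (finProdFinEquiv.symm j).1)
    (X.noise (finProdFinEquiv.symm j).2)
  contMDiff_drift := Bundle.contMDiff_zeroSection ℝ (TangentSpace 𝓘(ℝ, F))
  contMDiff_noise := fun _ => contMDiff_sectionField hp (hχ _) (hW _) (hχW _) (hs _)
    (X.contMDiff_noise _)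

lemma vecLieDeriv_liftedNoise {k K : ℕ} (X : SDS 𝓘(ℝ, E) M k) {p : M → N}
    (hp : ContMDiff 𝓘(ℝ, E) 𝓘(ℝ, F) ∞ p) {χ : Fin K → N → ℝ}
    (hχ : ∀ c, ContMDiff 𝓘(ℝ, F) 𝓘(ℝ, ℝ) ∞ (χ c)) {W : Fin K → Set N} (hW : ∀ c, IsOpen (W c))
    (hχW : ∀ c, tsupport (χ c) ⊆ W c) {s : Fin K → N → M}
    (hs : ∀ c, ∀ y ∈ W c, ContMDiffAt 𝓘(ℝ, F) 𝓘(ℝ, E) ∞ (s c) y ∧ p (s c y) = y)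
    {u : N → F'} {y : N} (hu : MDifferentiableAt 𝓘(ℝ, F) 𝓘(ℝ, F') u y) (c : Fin K) (i : Fin k) :
    vecLieDeriv ((liftedNoise X hp hχ hW hχW hs).noise (finProdFinEquiv (c, i))) u y =
      χ c y • vecLieDeriv (X.noise i) (fun x => u (p x)) (s c y) := by
  simp only [liftedNoise, Equiv.symm_apply_apply]
  by_cases h : χ c y = 0
  · rw [vecLieDeriv_sectionField_of_eq_zero h, h, zero_smul]
  · exact vecLieDeriv_sectionField hp (hs c y (hχW c (subset_tsupport _ h))).2 _ hu

/-- The drift of the projection of `X`, given the noise fields. -/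
def projectedDrift {k m : ℕ} (X : SDS 𝓘(ℝ, E) M k) (Y : SDS 𝓘(ℝ, F) N m) (p : M → N) (σ : N → M) :
    (y : N) → TangentSpace 𝓘(ℝ, F) y :=
  -- The chart centred at `y` has the identity as derivative at `y`, so the value of the remaining
  -- first-order operator on this chart is the tangent vector itself. The section `σ` may be
  -- discontinuous.
  fun y => (X.vecGenerator (fun z => extChartAt 𝓘(ℝ, F) y (p z)) (σ y) -
    Y.noisePart (extChartAt 𝓘(ℝ, F) y) y : F)

lemma eventually_contMDiffAt_comp {p : M → N} (hp : ContMDiff 𝓘(ℝ, E) 𝓘(ℝ, F) ∞ p) {f : N → F'}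
    {x : M} (hf : ∀ᶠ y in 𝓝 (p x), ContMDiffAt 𝓘(ℝ, F) 𝓘(ℝ, F') ∞ f y) :
    ∀ᶠ z in 𝓝 x, ContMDiffAt 𝓘(ℝ, E) 𝓘(ℝ, F') ∞ (fun z => f (p z)) z := by
  filter_upwards [(hp.continuous.tendsto x).eventually hf] with z hz
  exact hz.comp z (hp z)

lemma eventually_contMDiffAt_extChartAt (y : N) :
    ∀ᶠ z in 𝓝 y, ContMDiffAt 𝓘(ℝ, F) 𝓘(ℝ, F) ∞ (extChartAt 𝓘(ℝ, F) y) z := by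
  filter_upwards [(chartAt F y).open_source.mem_nhds (mem_chart_source F y)] with z hz
  exact contMDiffAt_extChartAt' hz

section

variable {k K : ℕ} (X : SDS 𝓘(ℝ, E) M k) {p : M → N}
    (hp : ContMDiff 𝓘(ℝ, E) 𝓘(ℝ, F) ∞ p)
    (hinv : ∀ f : N → ℝ, ContMDiff 𝓘(ℝ, F) 𝓘(ℝ, ℝ) ∞ f → ∀ x x', p x = p x' →
      X.generator (f ∘ p) x = X.generator (f ∘ p) x')
    {χ : Fin K → N → ℝ} (hχ : ∀ c, ContMDiff 𝓘(ℝ, F) 𝓘(ℝ, ℝ) ∞ (χ c)) {W : Fin K → Set N}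
    (hW : ∀ c, IsOpen (W c)) (hχW : ∀ c, tsupport (χ c) ⊆ W c) (hχ1 : ∀ y, ∑ c, χ c y ^ 2 = 1)
    {s : Fin K → N → M}
    (hs : ∀ c, ∀ y ∈ W c, ContMDiffAt 𝓘(ℝ, F) 𝓘(ℝ, E) ∞ (s c) y ∧ p (s c y) = y)
    {σ : N → M} (hσ : ∀ y, p (σ y) = y)

include hinv hχ1 hσ

/-- The lifted noise and the projected drift give the projection of the generator. -/
lemma vecGenerator_comp_eq (f : N → F') (x : M)
    (hf : ∀ᶠ y in 𝓝 (p x), ContMDiffAt 𝓘(ℝ, F) 𝓘(ℝ, F') ∞ f y) :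
    X.vecGenerator (fun z => f (p z)) x =
      vecLieDeriv (projectedDrift X (liftedNoise X hp hχ hW hχW hs) p σ) f (p x) +
        (liftedNoise X hp hχ hW hχW hs).noisePart f (p x) := by
  set Y := liftedNoise X hp hχ hW hχW hs with hY
  obtain ⟨y, hxy⟩ : ∃ y, y = p x := ⟨_, rfl⟩
  rw [← hxy] at hf ⊢
  set u := extChartAt 𝓘(ℝ, F) y with hu
  have husm := eventually_contMDiffAt_extChartAt (F := F) y
  have hud : MDifferentiableAt 𝓘(ℝ, F) 𝓘(ℝ, F) u y :=
    husm.self_of_nhds.mdifferentiableAt (by simp)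
  set Φ : F → F' := fun v => f (u.symm v) with hΦdef
  have hfΦ : f =ᶠ[𝓝 y] fun z => Φ (u z) := by
    filter_upwards [extChartAt_source_mem_nhds (I := 𝓘(ℝ, F)) y] with z hz
    simp only [hΦdef, hu]
    rw [(extChartAt 𝓘(ℝ, F) y).left_inv hz]
  have hsymm : Tendsto u.symm (𝓝 (u y)) (𝓝 y) := by
    have := (continuousAt_extChartAt_symm (I := 𝓘(ℝ, F)) y).tendsto
    rwa [extChartAt_to_inv] at this
  have hΦ : ∀ᶠ v in 𝓝 (u y), ContDiffAt ℝ ∞ Φ v := by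
    filter_upwards [eventually_mem_nhds_iff.2 (extChartAt_target_mem_nhds (I := 𝓘(ℝ, F)) y),
      hsymm.eventually hf] with v h1 h2
    rw [← contMDiffAt_iff_contDiffAt]
    exact h2.comp v ((contMDiffOn_extChartAt_symm y).contMDiffAt h1)
  set a : Fin k → M → F := fun i => vecLieDeriv (X.noise i) (fun z => u (p z)) with ha
  set q : M → F' := fun x' => (1 / 2 : ℝ) • ∑ i, fderiv ℝ (fderiv ℝ Φ) (u y) (a i x') (a i x')
    with hq
  set B : F := X.vecGenerator (fun z => u (p z)) (σ y) with hB
  -- Both `A_X (f ∘ p)` and `A_X (u ∘ p)` are constant on the fibre, hence so is the Hessian term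
  -- `q`.
  have hgen : ∀ x', p x' = y → X.vecGenerator (fun z => f (p z)) x = fderiv ℝ Φ (u y) B + q x' := by
    intro x' hx'
    have hxx' : p x = p x' := by rw [hx', hxy]
    have hσx' : p (σ y) = p x' := by rw [hσ, hx']
    rw [X.vecGenerator_eq_of_fibre hp hinv hxx' (by rwa [← hxy]), hB,
      X.vecGenerator_eq_of_fibre hp hinv hσx' (by rwa [hσ])]
    have h1 : (fun z => f (p z)) =ᶠ[𝓝 x'] fun z => Φ (u (p z)) := by
      have := hp.continuous.tendsto x'
      rw [hx'] at this
      exact this.eventually hfΦ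
    rw [(X.vecGenerator_congr h1).self_of_nhds]
    have h2 := X.vecGenerator_comp (f := fun z => u (p z)) (x := x')
      (eventually_contMDiffAt_comp hp (by rwa [hx'])) (Φ := Φ) (by simp only [hx']; exact hΦ)
    rw [h2]
    simp only [hx', hq, ha]
  have hnoise : Y.noisePart f y = fderiv ℝ Φ (u y) (Y.noisePart u y) + q x := by
    rw [(Y.noisePart_congr hfΦ).self_of_nhds, Y.noisePart_comp husm hΦ]
    congr 1
    have h1 : ∀ c i, fderiv ℝ (fderiv ℝ Φ) (u y)
        (vecLieDeriv (Y.noise (finProdFinEquiv (c, i))) u y)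
        (vecLieDeriv (Y.noise (finProdFinEquiv (c, i))) u y) =
        χ c y ^ 2 • fderiv ℝ (fderiv ℝ Φ) (u y) (a i (s c y)) (a i (s c y)) := by
      intro c i
      rw [hY, vecLieDeriv_liftedNoise X hp hχ hW hχW hs hud c i, map_smul, map_smul,
        smul_apply, smul_smul, sq]
    have h4 : ∑ j, fderiv ℝ (fderiv ℝ Φ) (u y) (vecLieDeriv (Y.noise j) u y)
        (vecLieDeriv (Y.noise j) u y) =
        ∑ c, χ c y ^ 2 • ∑ i, fderiv ℝ (fderiv ℝ Φ) (u y) (a i (s c y)) (a i (s c y)) := by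
      refine (Equiv.sum_comp finProdFinEquiv _).symm.trans
        ((Fintype.sum_prod_type _).trans (Finset.sum_congr rfl fun c _ => ?_))
      rw [Finset.smul_sum]
      exact Finset.sum_congr rfl fun i _ => h1 c i
    rw [h4, Finset.smul_sum]
    -- Where `χ c y ≠ 0`, the point `s c y` lies in the fibre of `x` and `q (s c y) = q x`; since
    -- the squares sum to `1`, the total is `q x`.
    have h2 : ∀ c, (1 / 2 : ℝ) • χ c y ^ 2 • ∑ i, fderiv ℝ (fderiv ℝ Φ) (u y) (a i (s c y))
        (a i (s c y)) = χ c y ^ 2 • q x := by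
      intro c
      by_cases h : χ c y = 0
      · simp [h]
      · have h3 := (hgen (s c y) (hs c y (hχW c (subset_tsupport _ h))).2).symm.trans
          (hgen x hxy.symm)
        rw [← add_left_cancel h3, hq, smul_comm]
    simp only [h2]
    rw [← Finset.sum_smul, hχ1, one_smul]
  have hdrift : vecLieDeriv (projectedDrift X Y p σ) f y =
      fderiv ℝ Φ (u y) (B - Y.noisePart u y) := by
    rw [(hfΦ.vecLieDeriv _).self_of_nhds,
      vecLieDeriv_comp _ hud (hΦ.self_of_nhds.differentiableAt (by simp))]
    congr 1
    exact mvfderiv_extChartAt_apply_self y _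
  rw [hgen x hxy.symm, hnoise, hdrift, map_sub]
  abel

/-- The projected drift is smooth. -/
lemma contMDiff_projectedDrift :
    ContMDiff 𝓘(ℝ, F) 𝓘(ℝ, F).tangent ∞ (fun y =>
      (⟨y, projectedDrift X (liftedNoise X hp hχ hW hχW hs) p σ y⟩ : TangentBundle 𝓘(ℝ, F) N)) := by
  refine contMDiff_section_of_coordinates fun y₀ => ?_
  set Y := liftedNoise X hp hχ hW hχW hs with hY
  set u := extChartAt 𝓘(ℝ, F) y₀ with hu
  have husm := eventually_contMDiffAt_extChartAt (F := F) y₀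
  -- Near `y₀` a smooth section `s c` can take the place of the arbitrary `σ`.
  obtain ⟨c, -, hc⟩ := Finset.exists_ne_zero_of_sum_ne_zero (by rw [hχ1 y₀]; exact one_ne_zero)
  have hy₀ : y₀ ∈ W c := hχW c (subset_tsupport _ fun h => hc (by rw [h]; simp))
  have h1 : ContMDiffAt 𝓘(ℝ, F) 𝓘(ℝ, F) ∞
      (fun y => X.vecGenerator (fun z => u (p z)) (s c y) - Y.noisePart u y) y₀ := by
    refine ContMDiffAt.sub ?_ (Y.eventually_contMDiffAt_noisePart husm).self_of_nhds
    refine ContMDiffAt.comp (I' := 𝓘(ℝ, E)) (g := X.vecGenerator (fun z => u (p z))) y₀ ?_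
      (hs c y₀ hy₀).1
    refine (X.eventually_contMDiffAt_vecGenerator (eventually_contMDiffAt_comp hp ?_)).self_of_nhds
    rwa [(hs c y₀ hy₀).2]
  refine h1.congr_of_eventuallyEq ?_
  filter_upwards [husm.eventually_nhds, (hW c).mem_nhds hy₀] with y hy hyW
  -- The projection identity for the chart `u`, taken at `s c y`, is solved for the derivative of
  -- `u` along the drift.
  have h2 := vecGenerator_comp_eq X hp hinv hχ hW hχW hχ1 hs hσ u (s c y)
    (by rwa [(hs c y hyW).2])
  rw [(hs c y hyW).2] at h2
  exact eq_sub_of_add_eq h2.symm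

end

/-- A generator which maps functions of `p` to functions of `p`, for a surjective submersion `p`,
is projected by `p` to the generator of a stochastic dynamical system. -/
theorem exists_projected_SDS {d k : ℕ} {N : Type*} [TopologicalSpace N] [T2Space N]
    [SecondCountableTopology N] [ChartedSpace (EuclideanSpace ℝ (Fin d)) N]
    [IsManifold (𝓡 d) ∞ N] (X : SDS 𝓘(ℝ, E) M k) {p : M → N}
    (hp : ContMDiff 𝓘(ℝ, E) (𝓡 d) ∞ p) (hps : Function.Surjective p)
    (hpd : ∀ x, Function.Surjective (mfderiv 𝓘(ℝ, E) (𝓡 d) p x))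
    (hinv : ∀ f : N → ℝ, ContMDiff (𝓡 d) 𝓘(ℝ, ℝ) ∞ f → ∀ x x', p x = p x' →
      X.generator (f ∘ p) x = X.generator (f ∘ p) x') :
    ∃ (m : ℕ) (Z : SDS (𝓡 d) N m), ∀ f : N → ℝ, ContMDiff (𝓡 d) 𝓘(ℝ, ℝ) ∞ f →
      X.generator (f ∘ p) = Z.generator f ∘ p := by
  have : LocallyCompactSpace N := ChartedSpace.locallyCompactSpace (EuclideanSpace ℝ (Fin d)) N
  -- A finite number of sections is essential: the projected system has `K * k` noise fields.
  obtain ⟨K, W, s, hW, hcov, hs⟩ := exists_finite_cover_of_local d (N := N) (T := M)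
    (Q := fun s y => ContMDiffAt (𝓡 d) 𝓘(ℝ, E) ∞ s y ∧ p (s y) = y)
    (fun s s' y h hQ => ⟨hQ.1.congr_of_eventuallyEq h.symm, by rw [← h.self_of_nhds]; exact hQ.2⟩)
    (fun y => by
      obtain ⟨x, rfl⟩ := hps y
      obtain ⟨s, -, hs⟩ := exists_localSection (Eventually.of_forall hp) (hpd x)
      exact ⟨s, hs⟩)
  obtain ⟨χ, hχ, hχW, hχ1⟩ := exists_sum_sq_eq_one (F := EuclideanSpace ℝ (Fin d)) hW hcov
  have hσ : ∀ y, p (Function.surjInv hps y) = y := Function.surjInv_eq hps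
  set Y := liftedNoise X hp hχ hW hχW hs with hY
  refine ⟨K * k, ⟨projectedDrift X Y p (Function.surjInv hps), Y.noise,
    contMDiff_projectedDrift X hp hinv hχ hW hχW hχ1 hs hσ, Y.contMDiff_noise⟩, fun f hf => ?_⟩
  funext x
  exact vecGenerator_comp_eq X hp hinv hχ hW hχW hχ1 hs hσ f x (Eventually.of_forall hf)

end ProjectedSDS

/-! ### Restriction to open sets and padding with zero noise -/

section Restrict

variable {E F : Type*} [NormedAddCommGroup E] [NormedSpace ℝ E]
  [NormedAddCommGroup F] [NormedSpace ℝ F]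
  {M N : Type*} [TopologicalSpace M] [ChartedSpace E M]
  [TopologicalSpace N] [ChartedSpace F N]

lemma surjective_mfderiv_of_rightInverse {φ : M → N} {ψ : N → M} {w : N}
    (hφ : MDifferentiableAt 𝓘(ℝ, E) 𝓘(ℝ, F) φ (ψ w))
    (hψ : MDifferentiableAt 𝓘(ℝ, F) 𝓘(ℝ, E) ψ w) (h : φ ∘ ψ = id) :
    Function.Surjective (mfderiv 𝓘(ℝ, E) 𝓘(ℝ, F) φ (ψ w)) := by
  have h1 := mfderiv_comp w hφ hψ
  rw [h, mfderiv_id] at h1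
  exact fun v => ⟨mfderiv 𝓘(ℝ, F) 𝓘(ℝ, E) ψ w v, (DFunLike.congr_fun h1 v).symm⟩

variable [IsManifold 𝓘(ℝ, E) ∞ M]

lemma vecLieDeriv_mpullback_subtypeVal (U : Opens M) (V : (x : M) → TangentSpace 𝓘(ℝ, E) x)
    {f : M → F} {x : U} (hf : MDifferentiableAt 𝓘(ℝ, E) 𝓘(ℝ, F) f x.1) :
    vecLieDeriv (VectorField.mpullback 𝓘(ℝ, E) 𝓘(ℝ, E) (Subtype.val : U → M) V)
      (fun z : U => f z.1) x = vecLieDeriv V f x.1 := by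
  have hv : MDifferentiableAt 𝓘(ℝ, E) 𝓘(ℝ, E) (Subtype.val : U → M) x :=
    (contMDiff_subtype_val (n := ∞) x).mdifferentiableAt (by simp)
  refine ((hf.hasMFDerivAt.comp x hv.hasMFDerivAt).vecLieDeriv_eq _).trans ?_
  refine congrArg (mfderiv 𝓘(ℝ, E) 𝓘(ℝ, F) f x.1) ?_
  exact (isInvertible_mfderiv_subtypeVal U x).self_apply_inverse (V x.1)

lemma SDS.generator_restrict_apply [CompleteSpace E] {k : ℕ} (X : SDS 𝓘(ℝ, E) M k) (U : Opens M)
    {f : M → ℝ} (hf : ContMDiff 𝓘(ℝ, E) 𝓘(ℝ, ℝ) ∞ f) {u : U → ℝ} {x : U}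
    (hu : u =ᶠ[𝓝 x] fun z => f z.1) :
    (X.restrict U).generator u x = X.generator f x.1 := by
  simp only [SDS.generator_eq_vecGenerator]
  rw [((X.restrict U).vecGenerator_congr hu).self_of_nhds]
  have h1 : ∀ V : (x : M) → TangentSpace 𝓘(ℝ, E) x,
      vecLieDeriv (VectorField.mpullback 𝓘(ℝ, E) 𝓘(ℝ, E) (Subtype.val : U → M) V)
      (fun z : U => f z.1) = fun z => vecLieDeriv V f z.1 := fun V =>
    funext fun z => vecLieDeriv_mpullback_subtypeVal U V (hf.mdifferentiable (by simp) _)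
  have h2 : ∀ i, vecLieDeriv ((X.restrict U).noise i) (vecLieDeriv ((X.restrict U).noise i)
      (fun z : U => f z.1)) x = vecLieDeriv (X.noise i) (vecLieDeriv (X.noise i) f) x.1 := by
    intro i
    refine (congrArg (fun w => vecLieDeriv ((X.restrict U).noise i) w x) (h1 (X.noise i))).trans ?_
    exact vecLieDeriv_mpullback_subtypeVal U _ ((eventually_contMDiffAt_vecLieDeriv
      (X.contMDiff_noise i) (Eventually.of_forall hf)).self_of_nhds.mdifferentiableAt (by simp))
  simp only [SDS.vecGenerator, SDS.noisePart, h2]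
  rw [show vecLieDeriv (X.restrict U).drift (fun z : U => f z.1) x = vecLieDeriv X.drift f x.1 from
    congrFun (h1 X.drift) x]

variable (M) in
/-- The stochastic dynamical system with vanishing vector fields. -/
def SDS.zero (k : ℕ) : SDS 𝓘(ℝ, E) M k where
  drift := fun _ => 0
  noise := fun _ _ => 0
  contMDiff_drift := Bundle.contMDiff_zeroSection ℝ (TangentSpace 𝓘(ℝ, E))
  contMDiff_noise := fun _ => Bundle.contMDiff_zeroSection ℝ (TangentSpace 𝓘(ℝ, E))

/-- Adding noise terms which vanish. -/
def SDS.pad {k : ℕ} (X : SDS 𝓘(ℝ, E) M k) (l : ℕ) : SDS 𝓘(ℝ, E) M (k + l) where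
  drift := X.drift
  noise := Fin.append X.noise (fun _ _ => 0)
  contMDiff_drift := X.contMDiff_drift
  contMDiff_noise := fun i => by
    refine Fin.addCases (fun i => ?_) (fun i => ?_) i
    · simp only [Fin.append_left]; exact X.contMDiff_noise i
    · simp only [Fin.append_right]
      exact Bundle.contMDiff_zeroSection ℝ (TangentSpace 𝓘(ℝ, E))

lemma SDS.generator_pad {k : ℕ} (X : SDS 𝓘(ℝ, E) M k) (l : ℕ) (f : M → ℝ) :
    (X.pad l).generator f = X.generator f := by
  funext x
  have h : ∀ u : M → ℝ, lieDeriv (fun y => (0 : TangentSpace 𝓘(ℝ, E) y)) u x = 0 :=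
    fun u => map_zero _
  simp only [SDS.generator, SDS.pad, Fin.sum_univ_add, Fin.append_left, Fin.append_right, h,
    Finset.sum_const_zero, add_zero]

end Restrict

/-! ### Topology of the orbit projection -/

section OrbitSpace

variable {G M : Type*} [Group G] [MulAction G M]

lemma sameOrbitType_smul (g : G) (x : M) : SameOrbitType G x (g • x) :=
  ⟨g, stabilizer_smul_eq_stabilizer_map_conj g x⟩

variable [TopologicalSpace M]

lemma orbitProj_eq_iff {V : Opens (orbitRel.Quotient G M)} {x y : orbitPreimage V} :
    orbitProj V x = orbitProj V y ↔ ∃ g : G, g • x.1 = y.1 := by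
  rw [eq_comm, Subtype.ext_iff]
  exact Quotient.eq''.trans (orbitRel_apply.trans mem_orbit_iff)

lemma smul_mem_orbitPreimage {V : Opens (orbitRel.Quotient G M)} {x : M} (g : G)
    (hx : x ∈ orbitPreimage V) : g • x ∈ orbitPreimage V := by
  have h : (Quotient.mk _ (g • x) : orbitRel.Quotient G M) = Quotient.mk _ x :=
    Quotient.sound' (orbitRel_apply.2 (mem_orbit x g))
  change (Quotient.mk _ (g • x) : orbitRel.Quotient G M) ∈ V
  rw [h]
  exact hx

lemma orbitProj_surjective (V : Opens (orbitRel.Quotient G M)) :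
    Function.Surjective (orbitProj V) := by
  rintro ⟨y, hy⟩
  induction y using Quotient.inductionOn with
  | h x => exact ⟨⟨x, hy⟩, rfl⟩

lemma continuous_orbitProj (V : Opens (orbitRel.Quotient G M)) : Continuous (orbitProj V) :=
  (continuous_quotient_mk'.comp continuous_subtype_val).subtype_mk _

lemma isOpenMap_orbitProj [ContinuousConstSMul G M] (V : Opens (orbitRel.Quotient G M)) :
    IsOpenMap (orbitProj V) :=
  (isOpenMap_quotient_mk'_mul (Γ := G) (T := M)).restrictPreimage (V : Set (orbitRel.Quotient G M))

lemma IsRegularPoint.smul [ContinuousConstSMul G M] {x : M} (hx : IsRegularPoint G x) (g : G) :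
    IsRegularPoint G (g • x) := by
  have h1 : Tendsto (fun y : M => g⁻¹ • y) (𝓝 (g • x)) (𝓝 x) := by
    simpa using (continuous_const_smul g⁻¹).tendsto (g • x)
  refine (h1.eventually hx).mono fun y hy => ?_
  have h2 := ((sameOrbitType_smul g x).symm G).trans G (hy.trans G (sameOrbitType_smul g (g⁻¹ • y)))
  rwa [smul_inv_smul] at h2

/-- The map `(g, x) ↦ (g • x, x)` is a closed embedding into `G × (M × M)` followed by the
projection along the compact factor `G`. Properness makes the orbit space Hausdorff. -/
lemma properSMul_of_compactSpace [TopologicalSpace G] [T2Space G] [CompactSpace G] [T2Space M]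
    [ContinuousSMul G M] : ProperSMul G M := by
  constructor
  have h1 : IsClosedEmbedding (fun q : G × M => (q.1, (q.1 • q.2, q.2))) :=
    Function.LeftInverse.isClosedEmbedding (f := fun q : G × (M × M) => (q.1, q.2.2))
      (fun q => rfl) (by fun_prop) (by fun_prop)
  exact isProperMap_snd_of_compactSpace.comp h1.isProperMap

end OrbitSpace

/-! ### The pieces of the regular part, by codimension of orbits -/

section RegularPiece

variable (A E G : Type*) {M : Type*} [NormedAddCommGroup A] [NormedSpace ℝ A] [FiniteDimensional ℝ A]
  [NormedAddCommGroup E] [NormedSpace ℝ E] [FiniteDimensional ℝ E]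
  [TopologicalSpace M] [T2Space M] [ChartedSpace E M] [IsManifold 𝓘(ℝ, E) ∞ M]
  [Group G] [TopologicalSpace G] [CompactSpace G] [ChartedSpace A G] [LieGroup 𝓘(ℝ, A) ∞ G]
  [MulAction G M] [ContinuousSMul G M] [ContMDiffSMul 𝓘(ℝ, A) 𝓘(ℝ, E) ∞ G M]

/-- Orbit dimension depends only on orbit type, so it is locally constant on regular points. -/
lemma isOpen_setOf_isRegularPoint_codim (d : ℕ) : IsOpen
    {x : M | IsRegularPoint G x ∧ Module.finrank ℝ E - orbitRank A E G x = d} := by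
  rw [isOpen_iff_mem_nhds]
  rintro x ⟨hx, hd⟩
  have hx' : ∀ᶠ y in 𝓝 x, SameOrbitType G x y := hx
  filter_upwards [(isOpen_setOf_isRegularPoint G).mem_nhds hx, hx'] with y hy hxy
  exact ⟨hy, by rw [hxy.orbitRank_eq (A := A) (E := E), hd]⟩

variable (M) in
/-- The orbits of codimension `d` in the regular part of the orbit space. -/
def regularPiece (d : ℕ) : Opens (orbitRel.Quotient G M) where
  carrier := Quotient.mk _ ''
    {x : M | IsRegularPoint G x ∧ Module.finrank ℝ E - orbitRank A E G x = d}
  is_open' := isOpenMap_quotient_mk'_mul _ (isOpen_setOf_isRegularPoint_codim A E G d)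

variable {A E G}

lemma mk_mem_regularPiece {d : ℕ} {x : M} :
    (Quotient.mk _ x : orbitRel.Quotient G M) ∈ regularPiece A E G M d ↔
      IsRegularPoint G x ∧ Module.finrank ℝ E - orbitRank A E G x = d := by
  refine ⟨?_, fun h => ⟨x, h, rfl⟩⟩
  rintro ⟨y, ⟨hy, hd⟩, hyx⟩
  obtain ⟨g, rfl⟩ := mem_orbit_iff.1 (orbitRel_apply.1 (Quotient.eq''.1 hyx.symm))
  exact ⟨hy.smul g, by rw [orbitRank_smul, hd]⟩

variable (A E G M)

lemma pairwise_disjoint_regularPiece :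
    Pairwise (Function.onFun Disjoint (regularPiece A E G M)) := by
  intro d d' hdd'
  refine Opens.coe_disjoint.1 (Set.disjoint_left.2 ?_)
  intro y
  induction y using Quotient.inductionOn with
  | h x =>
    intro h h'
    exact hdd' ((mk_mem_regularPiece.1 h).2.symm.trans (mk_mem_regularPiece.1 h').2)

lemma iSup_regularPiece : ⨆ d, regularPiece A E G M d = regularPart G M := by
  ext y
  rw [SetLike.mem_coe, Opens.mem_iSup]
  constructor
  · rintro ⟨d, x, hx, rfl⟩
    exact ⟨x, hx.1, rfl⟩
  · rintro ⟨x, hx, rfl⟩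
    exact ⟨_, x, ⟨hx, rfl⟩, rfl⟩

/-- The orbits of a given codimension in the regular part of the orbit space form a manifold. -/
theorem exists_manifold_regularPiece (d : ℕ) :
    ∃ _ : ChartedSpace (EuclideanSpace ℝ (Fin d)) (regularPiece A E G M d),
      IsManifold (𝓡 d) ∞ (regularPiece A E G M d) ∧
      ContMDiff 𝓘(ℝ, E) (𝓡 d) ∞ (orbitProj (regularPiece A E G M d)) ∧
      ∀ x, Function.Surjective
        (mfderiv 𝓘(ℝ, E) (𝓡 d) (orbitProj (regularPiece A E G M d)) x) := by
  have : IsTopologicalGroup G := topologicalGroup_of_lieGroup 𝓘(ℝ, A) ∞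
  set V := regularPiece A E G M d with hV
  have hval : ContMDiff 𝓘(ℝ, E) 𝓘(ℝ, E) ∞ (Subtype.val : orbitPreimage V → M) :=
    contMDiff_subtype_val
  refine exists_quotientManifold (E := E) (continuous_orbitProj V) (isOpenMap_orbitProj V)
    (orbitProj_surjective V) (fun x => ?_) (fun x w hxw => ?_)
  · obtain ⟨hx, hd⟩ := mk_mem_regularPiece.1 x.2
    obtain ⟨W, b, hW, hxW, hb⟩ := hx.exists_submersion hd
    refine ⟨⟨Subtype.val ⁻¹' W, fun y => b y.1, hW.preimage continuous_subtype_val,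
      fun y hy => (hb y hy).1.comp y (hval y), fun y hy => ?_, fun y hy y' hy' => ?_⟩, hxW⟩
    · obtain ⟨e, he⟩ := isInvertible_mfderiv_subtypeVal (I := 𝓘(ℝ, E)) (orbitPreimage V) y
      have h1 := mfderiv_comp y ((hb y hy).1.mdifferentiableAt (by simp))
        ((hval y).mdifferentiableAt (by simp))
      rw [← he] at h1
      have h2 : Function.Surjective
          ((mfderiv 𝓘(ℝ, E) (𝓡 d) b y.1) ∘ e) := (hb y hy).2.1.comp e.surjective
      intro v
      obtain ⟨w, hw⟩ := h2 v
      exact ⟨w, (DFunLike.congr_fun h1 w).trans hw⟩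
    · rw [orbitProj_eq_iff]
      exact (hb y hy).2.2.2 y' hy'
  · obtain ⟨g, hg⟩ := orbitProj_eq_iff.1 hxw
    have hsm : ∀ g : G, ContMDiff 𝓘(ℝ, E) 𝓘(ℝ, E) ∞
        (fun z : orbitPreimage V => (⟨g • z.1, smul_mem_orbitPreimage g z.2⟩ : orbitPreimage V)) := by
      intro g
      rw [← ContMDiff.subtypeVal_comp_iff]
      exact (ContMDiffSMul.contMDiff_const_smul (I := 𝓘(ℝ, A)) g).comp hval
    -- Translation by `g` is the fibre-preserving map carrying `x` to `w`; translation by `g⁻¹`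
    -- inverts it and makes its derivative surjective.
    refine ⟨_, hsm g, Subtype.ext hg, fun z => ?_, ?_⟩
    · exact (orbitProj_eq_iff.2 ⟨g, rfl⟩).symm
    · have h1 : (⟨g⁻¹ • w.1, smul_mem_orbitPreimage g⁻¹ w.2⟩ : orbitPreimage V) = x :=
        Subtype.ext (inv_smul_eq_iff.2 hg.symm)
      have h2 := surjective_mfderiv_of_rightInverse (w := w)
        ((hsm g).mdifferentiable (by simp) _) ((hsm g⁻¹).mdifferentiable (by simp) _)
        (funext fun z => Subtype.ext (by simp))
      rwa [h1] at h2

end RegularPiece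

/-! ### Invariance of the generator on functions of the orbit -/

section Projection

variable {E F G M : Type*} [NormedAddCommGroup E] [NormedSpace ℝ E] [FiniteDimensional ℝ E]
  [NormedAddCommGroup F] [NormedSpace ℝ F]
  [TopologicalSpace M] [T2Space M] [ChartedSpace E M] [IsManifold 𝓘(ℝ, E) ∞ M]
  [Group G] [MulAction G M] [ContinuousConstSMul G M]

/-- The generator of an invariant system maps functions of the orbit to functions of the orbit. -/
lemma SDS.IsDiffusionInvariant.generator_restrict_eq [CompleteSpace E] {k : ℕ}
    {X : SDS 𝓘(ℝ, E) M k} (hX : X.IsDiffusionInvariant G) (V : Opens (orbitRel.Quotient G M))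
    {u : V → ℝ} (hu : ContMDiff 𝓘(ℝ, E) 𝓘(ℝ, ℝ) ∞ (u ∘ orbitProj V))
    {x x' : orbitPreimage V} (h : orbitProj V x = orbitProj V x') :
    (X.restrict (orbitPreimage V)).generator (u ∘ orbitProj V) x =
      (X.restrict (orbitPreimage V)).generator (u ∘ orbitProj V) x' := by
  classical
  obtain ⟨g, hg⟩ := orbitProj_eq_iff.1 h
  -- Diffusion invariance tests only smooth functions on all of `M`. The extension by zero need not
  -- be smooth, but only its germ at `x'` matters and a cutoff globalises that germ to `f`.
  set f₀ : M → ℝ := fun z => if hz : z ∈ orbitPreimage V then u (orbitProj V ⟨z, hz⟩) else 0 with hf₀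
  have hf₀U : (fun z : orbitPreimage V => f₀ z.1) = u ∘ orbitProj V := by
    funext z
    have hz : z.1 ∈ orbitPreimage V := z.2
    simp [hf₀, hz]
  have hf₀s : ∀ᶠ z in 𝓝 x'.1, ContMDiffAt 𝓘(ℝ, E) 𝓘(ℝ, ℝ) ∞ f₀ z := by
    filter_upwards [(orbitPreimage V).isOpen.mem_nhds x'.2] with z hz
    refine (contMDiffAt_subtype_iff (x := (⟨z, hz⟩ : orbitPreimage V))).1 ?_
    rw [hf₀U]
    exact hu _
  obtain ⟨f, hf, hff₀⟩ := exists_contMDiff_eventuallyEq hf₀s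
  have hgs : ContMDiff 𝓘(ℝ, E) 𝓘(ℝ, E) ∞ (fun z : M => g • z) := (hX g).1
  have h1 : u ∘ orbitProj V =ᶠ[𝓝 x'] fun z : orbitPreimage V => f z.1 := by
    rw [← hf₀U]
    exact (continuous_subtype_val.tendsto x').eventually hff₀.symm
  -- Near `x` the translate of `f` by `g` represents the same function, which is constant on orbits.
  have h2 : u ∘ orbitProj V =ᶠ[𝓝 x] fun z : orbitPreimage V => (f ∘ fun y => g • y) z.1 := by
    have h3 : Tendsto (fun z : orbitPreimage V => g • z.1) (𝓝 x) (𝓝 x'.1) := by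
      rw [← hg]
      exact (hgs.continuous.comp continuous_subtype_val).tendsto x
    filter_upwards [h3.eventually hff₀] with z hz
    have hz' : g • z.1 ∈ orbitPreimage V := smul_mem_orbitPreimage g z.2
    have h4 : orbitProj V ⟨g • z.1, hz'⟩ = orbitProj V z := (orbitProj_eq_iff.2 ⟨g, rfl⟩).symm
    simp only [Function.comp_apply, hz, hf₀, hz', dif_pos, h4]
  rw [X.generator_restrict_apply (orbitPreimage V) hf h1, X.generator_restrict_apply (orbitPreimage V) (hf.comp hgs) h2,
    (hX g).2 f hf, ← hg]
  rfl

end Projection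

end

/-! ### The main theorem -/

theorem mainTheorem1 (n p : ℕ)
    (M : Type*) [TopologicalSpace M] [T2Space M] [SecondCountableTopology M]
    [ChartedSpace (EuclideanSpace ℝ (Fin n)) M] [IsManifold (𝓡 n) ∞ M]
    (G : Type*) [Group G] [TopologicalSpace G] [T2Space G] [CompactSpace G]
    [ChartedSpace (EuclideanSpace ℝ (Fin p)) G] [LieGroup (𝓡 p) ∞ G]
    [MulAction G M] [ContinuousSMul G M] [ContMDiffSMul (𝓡 p) (𝓡 n) ∞ G M]
    (k : ℕ) (X : SDS (𝓡 n) M k) (hX : X.IsDiffusionInvariant G) :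
    ∃ (S : OrbitManifold (𝓡 n) (regularPart G M)) (m : ℕ)
      (Z : ∀ d : ℕ, SDS (𝓡 d) (S.piece d) m),
      ∀ d : ℕ, IsDiffusionMorphism (X.restrict (orbitPreimage (S.piece d))) (Z d)
        (orbitProj (S.piece d)) := by
  have : IsTopologicalGroup G := topologicalGroup_of_lieGroup (𝓡 p) ∞
  have : ProperSMul G M := properSMul_of_compactSpace
  have : SecondCountableTopology (orbitRel.Quotient G M) :=
    ContinuousConstSMul.secondCountableTopology
  have : T2Space (orbitRel.Quotient G M) := t2Space_quotient_mulAction_of_properSMul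
  choose cs hcs hproj hsurj using
    exists_manifold_regularPiece (EuclideanSpace ℝ (Fin p)) (EuclideanSpace ℝ (Fin n)) G M
  let S : OrbitManifold (𝓡 n) (regularPart G M) :=
    { piece := regularPiece (EuclideanSpace ℝ (Fin p)) (EuclideanSpace ℝ (Fin n)) G M
      disjoint_piece := pairwise_disjoint_regularPiece _ _ G M
      iSup_piece := iSup_regularPiece _ _ G M
      chartedSpace := cs
      isManifold := hcs
      contMDiff_proj := hproj
      surjective_mfderiv_proj := hsurj }
  have hZ : ∀ d, ∃ (m : ℕ) (Z : SDS (𝓡 d) (S.piece d) m), ∀ f : S.piece d → ℝ,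
      ContMDiff (𝓡 d) 𝓘(ℝ, ℝ) ∞ f →
      (X.restrict (orbitPreimage (S.piece d))).generator (f ∘ orbitProj (S.piece d)) =
        Z.generator f ∘ orbitProj (S.piece d) := fun d =>
    exists_projected_SDS _ (S.contMDiff_proj d) (orbitProj_surjective _)
      (S.surjective_mfderiv_proj d) fun f hf _ _ h =>
        hX.generator_restrict_eq _ (hf.comp (S.contMDiff_proj d)) h
  choose m Z hZ using hZ
  have hempty : ∀ d, n < d → IsEmpty (orbitPreimage (S.piece d)) := fun d hd => ⟨fun x => by
    have h := (mk_mem_regularPiece.1 x.2).2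
    rw [finrank_euclideanSpace_fin] at h
    omega⟩
  -- One number of noise terms must serve every piece: the pieces with `d > n` are empty, and for `d
  -- ≤ n` the systems are padded with zero fields up to the largest `m d`.
  have hZ' : ∀ d, ∃ Z' : SDS (𝓡 d) (S.piece d) ((Finset.range (n + 1)).sup m),
      ∀ f : S.piece d → ℝ, ContMDiff (𝓡 d) 𝓘(ℝ, ℝ) ∞ f →
      (X.restrict (orbitPreimage (S.piece d))).generator (f ∘ orbitProj (S.piece d)) =
        Z'.generator f ∘ orbitProj (S.piece d) := by
    intro d
    rcases lt_or_ge n d with hd | hd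
    · exact ⟨SDS.zero _ _, fun f _ => funext fun x => ((hempty d hd).false x).elim⟩
    · obtain ⟨l, hl⟩ := Nat.exists_eq_add_of_le
        (Finset.le_sup (f := m) (Finset.mem_range.2 (Nat.lt_succ_of_le hd)))
      rw [hl]
      exact ⟨(Z d).pad l, fun f hf => by rw [SDS.generator_pad]; exact hZ d f hf⟩
  choose Z' hZ' using hZ'
  exact ⟨S, _, Z', fun d => ⟨S.contMDiff_proj d, hZ' d⟩⟩
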